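/- Let $k\ge 1$, let $n_1,\dots,n_k$ and $m_1,\dots,m_k$ be positive integers, and let $\mathcal K$ be a separable complex Hilbert space. Inner products are linear in the first variable. **Fock spaces.** For each $i$, let $\mathbb F_{n_i}^+$ be the free unital semigroup with generators $g^i_1,\dots,g^i_{n_i}$ and identity $g^i_0$, let $|\alpha|$ be the length of a word $\alpha$, and let $F^2(H_{n_i})$ be the full Fock space of an $n_i$-dimensional complex Hilbert space, with its orthonormal basis $\{e^i_\alpha\}_{\alpha\in\mathbb F_{n_i}^+}$. Put $b^{(m_i)}_{i,\alpha}:=\binom{|\alpha|+m_i-1}{m_i-1}$. Let $\Lambda_{i,j}$ be the weighted right creation operators on $F^2(H_{n_i})$, $$\Lambda_{i,j}e^i_\alpha=\sqrt{\frac{b^{(m_i)}_{i,\alpha}}{b^{(m_i)}_{i,g^i_j\alpha}}}\;e^i_{\alpha g^i_j},\qquad 1\le j\le n_i,\ \alpha\in\mathbb F_{n_i}^+ .$$ Let $\mathcal E:=\mathcal K\otimes F^2(H_{n_1})\otimes\cdots\otimes F^2(H_{n_k})$ (Hilbert tensor product), and let $\widetilde{\mathbf\Lambda}_{i,j}$ be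 the operator on $\mathcal E$ that acts as $\Lambda_{i,j}$ on the factor $F^2(H_{n_i})$ and as the identity on all other factors. Put $\widetilde{\mathbf\Lambda}_{i,\beta}:=\widetilde{\mathbf\Lambda}_{i,j_1}\cdots\widetilde{\mathbf\Lambda}_{i,j_p}$ for $\beta=g^i_{j_1}\cdots g^i_{j_p}$, and $\widetilde{\mathbf\Lambda}_{i,g_0^i}:=I$. Let $\widetilde{\mathbf\Lambda}_i:=[\widetilde{\mathbf\Lambda}_{i,1}\cdots\widetilde{\mathbf\Lambda}_{i,n_i}]:\mathcal E^{(n_i)}\to\mathcal E$ be the row operator; $\widetilde{\mathbf\Lambda}_i^*\widetilde{\mathbf\Lambda}_i$ is invertible, and the Cauchy dual of $\widetilde{\mathbf\Lambda}_i$ is $\widetilde{\mathbf\Lambda}_i':=\widetilde{\mathbf\Lambda}_i(\widetilde{\mathbf\Lambda}_i^*\widetilde{\mathbf\Lambda}_i)^{-1}$. **Brown–Halmos condition.** A bounded operator $T$ on $\mathcal E$ satisfies the Brown–Halmos condition if, for every $i\in\{1,\dots,k\}$, $$\widetilde{\mathbf\Lambda}_i'^{*}\,T\,\widetilde{\mathbf\Lambda}_i'=\mathrm{diag}_{n_i}\Bigl(\sum_{j=0}^{m_i-1}(-1)^j\binom{m_i}{j+1}\sum_{\beta\in\mathbb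 F_{n_i}^+,\,|\beta|=j}\widetilde{\mathbf\Lambda}_{i,\beta}\,T\,\widetilde{\mathbf\Lambda}_{i,\beta}^*\Bigr),$$ where $\mathrm{diag}_{n}(A)$ denotes the direct sum of $n$ copies of $A$. **Weighted multi-Toeplitz operators.** For words $\omega,\gamma$ in the same $\mathbb F_{n_i}^+$ write $\omega\ge_r\gamma$ if $\omega=\sigma\gamma$ for a (unique) word $\sigma$, and then put $\omega\backslash_r\gamma:=\sigma$; if $\omega\not\ge_r\gamma$ put $\omega\backslash_r\gamma:=g_0^i$. Let $\mathbf F:=\mathbb F_{n_1}^+\times\cdots\times\mathbb F_{n_k}^+$. Let $\mathcal C$ be the set of comparable pairs $(\boldsymbol\omega,\boldsymbol\gamma)\in\mathbf F\times\mathbf F$, i.e. those for which $\omega_i\ge_r\gamma_i$ or $\gamma_i\ge_r\omega_i$ for every $i$. Let $\mathcal J$ be the set of pairs $(\boldsymbol\sigma,\boldsymbol\beta)\in\mathbf F\times\mathbf F$ for which there are $s_1,\dots,s_k\in\mathbb Z$ with $|\sigma_i|=s_i^+=\max(s_i,0)$ and $|\beta_i|=s_i^-=\max(-s_i,0)$ for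 every $i$. Define $\mathbf s:\mathcal C\to\mathcal J$ by $\mathbf s(\boldsymbol\omega,\boldsymbol\gamma):=\bigl((\omega_i\backslash_r\gamma_i)_i,(\gamma_i\backslash_r\omega_i)_i\bigr)$, and put $$\tau_{(\boldsymbol\omega,\boldsymbol\gamma)}:=\prod_{i=1}^k\sqrt{\frac{b^{(m_i)}_{i,\min\{\omega_i,\gamma_i\}}}{b^{(m_i)}_{i,\max\{\omega_i,\gamma_i\}}}},\qquad(\boldsymbol\omega,\boldsymbol\gamma)\in\mathcal C,$$ with $\min$ and $\max$ taken with respect to $\le_r$. With $e_{\boldsymbol\gamma}:=e^1_{\gamma_1}\otimes\cdots\otimes e^k_{\gamma_k}$, a bounded operator $T$ on $\mathcal E$ is called weighted (right) multi-Toeplitz if there are bounded operators $A_{(\boldsymbol\sigma;\boldsymbol\beta)}$ on $\mathcal K$, $(\boldsymbol\sigma,\boldsymbol\beta)\in\mathcal J$, such that for all $\boldsymbol\omega,\boldsymbol\gamma\in\mathbf F$ and $x,y\in\mathcal K$ $$\langle T(x\otimes e_{\boldsymbol\gamma}),\,y\otimes e_{\boldsymbol\omega}\rangle=\begin{cases}\tau_{(\boldsymbol\omega,\boldsymbol\gamma)}\,\langle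 A_{\mathbf s(\boldsymbol\omega,\boldsymbol\gamma)}x,y\rangle&\text{if }(\boldsymbol\omega,\boldsymbol\gamma)\in\mathcal C,\\ 0&\text{otherwise.}\end{cases}$$ **Theorem.** A bounded operator $T$ on $\mathcal K\otimes\bigotimes_{i=1}^kF^2(H_{n_i})$ satisfies the Brown–Halmos condition if and only if it is a weighted (right) multi-Toeplitz operator. -/

import Mathlib

open scoped ENNReal BigOperators InnerProductSpace

noncomputable section

namespace PolyHyperball

/-! ### Words and weights -/

/-- The unital free semigroup `𝔽ₙ⁺` on `n` generators. The product is concatenation of words and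
the identity `1` is the empty word `g₀`. -/
abbrev Word (n : ℕ) : Type := FreeMonoid (Fin n)

/-- The product `𝐅⁺ = 𝔽⁺_{n₁} × ⋯ × 𝔽⁺_{n_k}`. -/
abbrev MultiWord {k : ℕ} (n : Fin k → ℕ) : Type := ∀ i, Word (n i)

/-- The weight `b_β^{(m)} = binom(|β| + m - 1, m - 1)`, for `m ≥ 1`. (It is `1` at the empty
word.) -/
def b (m : ℕ) {n : ℕ} (β : Word n) : ℝ := ((β.length + m - 1).choose (m - 1) : ℕ)

/-- The diagonal entries `√(b_α / b_{g_j α})` of the operator `D_j`. -/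
def dWeight (m : ℕ) {n : ℕ} (j : Fin n) (α : Word n) : ℝ :=
  Real.sqrt (b m α / b m (FreeMonoid.of j * α))

theorem b_pos (m : ℕ) {n : ℕ} (β : Word n) : 0 < b m β := by
  unfold b
  exact_mod_cast Nat.choose_pos (by omega)

theorem dWeight_nonneg (m : ℕ) {n : ℕ} (j : Fin n) (α : Word n) : 0 ≤ dWeight m j α :=
  Real.sqrt_nonneg _

theorem dWeight_le_one (m : ℕ) {n : ℕ} (j : Fin n) (α : Word n) : dWeight m j α ≤ 1 := by
  unfold dWeight
  rw [Real.sqrt_le_one, div_le_one (b_pos _ _)]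
  unfold b
  have : (FreeMonoid.of j * α).length = α.length + 1 := by
    rw [FreeMonoid.length_mul, FreeMonoid.length_of, add_comm]
  rw [this]
  exact_mod_cast Nat.choose_le_choose _ (by omega)

theorem abs_dWeight_le_one (m : ℕ) {n : ℕ} (j : Fin n) (α : Word n) : |dWeight m j α| ≤ 1 := by
  rw [abs_of_nonneg (dWeight_nonneg _ _ _)]
  exact dWeight_le_one _ _ _

/-- `b_α / b_{g_j α} = (|α| + 1) / (|α| + m)`. -/
theorem dWeight_sq {m : ℕ} (hm : 1 ≤ m) {n : ℕ} (j : Fin n) (α : Word n) :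
    dWeight m j α ^ 2 = ((α.length : ℝ) + 1) / (α.length + m) := by
  unfold dWeight
  rw [Real.sq_sqrt (div_nonneg (b_pos _ _).le (b_pos _ _).le)]
  have hl : (FreeMonoid.of j * α).length = α.length + 1 := by
    rw [FreeMonoid.length_mul, FreeMonoid.length_of, add_comm]
  obtain ⟨q, rfl⟩ : ∃ q, m = q + 1 := ⟨m - 1, by omega⟩
  rw [div_eq_div_iff (b_pos _ _).ne' (by positivity)]
  unfold b
  rw [hl]
  have h := Nat.choose_mul_succ_eq (α.length + q) q
  have e1 : α.length + (q + 1) - 1 = α.length + q := by omega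
  have e2 : α.length + 1 + (q + 1) - 1 = α.length + q + 1 := by omega
  have e3 : α.length + q + 1 - q = α.length + 1 := by omega
  rw [e3] at h
  rw [e1, e2, Nat.add_sub_cancel]
  have h' : (((α.length + q).choose q * (α.length + q + 1) : ℕ) : ℝ)
      = (((α.length + q + 1).choose q * (α.length + 1) : ℕ) : ℝ) := by rw [h]
  push_cast at h' ⊢
  linarith

/-! ### Weighted shifts on `ℓ²` -/

theorem hasSum_norm_extend {I : Type*} {E : Type*} [NormedAddCommGroup E] [InnerProductSpace ℂ E]
    (σ : I → I) (hσ : Function.Injective σ) (w : I → ℝ) (hw : ∀ i, |w i| ≤ 1)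
    (F : lp (fun _ : I => E) 2) :
    Summable (fun i => ‖Function.extend σ (fun i => (w i : ℂ) • F i) 0 i‖ ^ 2) ∧
      ∑' i, ‖Function.extend σ (fun i => (w i : ℂ) • F i) 0 i‖ ^ 2
        = ∑' i, w i ^ 2 * ‖F i‖ ^ 2 ∧
      Summable (fun i => w i ^ 2 * ‖F i‖ ^ 2) := by
  have hs : Summable (fun i => ‖F i‖ ^ 2) := by
    have := (lp.memℓp F).summable (by norm_num)
    simpa using this
  have hs' : Summable (fun i => w i ^ 2 * ‖F i‖ ^ 2) := by
    refine Summable.of_nonneg_of_le (fun i => by positivity) (fun i => ?_) hs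
    have : w i ^ 2 ≤ 1 := by
      rw [← sq_abs]; exact pow_le_one₀ (abs_nonneg _) (hw i)
    nlinarith [sq_nonneg ‖F i‖]
  have he : (fun i => ‖Function.extend σ (fun i => (w i : ℂ) • F i) 0 i‖ ^ 2)
      = Function.extend σ (fun i => w i ^ 2 * ‖F i‖ ^ 2) 0 := by
    funext i
    by_cases h : ∃ a, σ a = i
    · obtain ⟨a, rfl⟩ := h
      rw [hσ.extend_apply, hσ.extend_apply, norm_smul, mul_pow]
      simp
    · rw [Function.extend_apply' _ _ _ h, Function.extend_apply' _ _ _ h]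
      simp
  rw [he]
  have hh := (hasSum_extend_zero hσ).2 hs'.hasSum
  exact ⟨hh.summable, hh.tsum_eq, hs'⟩

theorem memℓp_extend {I : Type*} {E : Type*} [NormedAddCommGroup E] [InnerProductSpace ℂ E]
    (σ : I → I) (hσ : Function.Injective σ) (w : I → ℝ) (hw : ∀ i, |w i| ≤ 1)
    (F : lp (fun _ : I => E) 2) :
    Memℓp (E := fun _ : I => E) (Function.extend σ (fun i => (w i : ℂ) • F i) 0) 2 := by
  refine memℓp_gen ?_
  simpa using (hasSum_norm_extend σ hσ w hw F).1

/-- The weighted shift on `ℓ²(I; E)` given by `δ_i ⊗ x ↦ w i • δ_{σ i} ⊗ x`, for an injective map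
`σ : I → I` and weights `|w| ≤ 1`: its value at `F` is the function which is `w i • F i` at `σ i`
and zero off the range of `σ`. -/
def weightedShift {I : Type*} {E : Type*} [NormedAddCommGroup E] [InnerProductSpace ℂ E]
    (σ : I → I) (hσ : Function.Injective σ) (w : I → ℝ) (hw : ∀ i, |w i| ≤ 1) :
    lp (fun _ : I => E) 2 →L[ℂ] lp (fun _ : I => E) 2 :=
  LinearMap.mkContinuous
    { toFun := fun F =>
        ⟨Function.extend σ (fun i => (w i : ℂ) • F i) 0, memℓp_extend σ hσ w hw F⟩
      map_add' := fun F G => by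
        apply lp.ext
        funext i
        simp only [lp.coeFn_add, Pi.add_apply]
        by_cases h : ∃ a, σ a = i
        · obtain ⟨a, rfl⟩ := h
          simp only [hσ.extend_apply, smul_add]
        · simp only [Function.extend_apply' _ _ _ h, Pi.zero_apply, add_zero]
      map_smul' := fun c F => by
        apply lp.ext
        funext i
        simp only [lp.coeFn_smul, Pi.smul_apply, RingHom.id_apply]
        by_cases h : ∃ a, σ a = i
        · obtain ⟨a, rfl⟩ := h
          simp only [hσ.extend_apply]
          rw [smul_comm]
        · simp only [Function.extend_apply' _ _ _ h, Pi.zero_apply, smul_zero] }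
    1 (fun F => by
      rw [one_mul]
      refine lp.norm_le_of_tsum_le (by norm_num) (norm_nonneg _) ?_
      rw [lp.norm_rpow_eq_tsum (by norm_num) F]
      have h := hasSum_norm_extend σ hσ w hw F
      have hs : Summable (fun i => ‖F i‖ ^ 2) := by
        have := (lp.memℓp F).summable (by norm_num)
        simpa using this
      have h2 : ∑' i, w i ^ 2 * ‖F i‖ ^ 2 ≤ ∑' i, ‖F i‖ ^ 2 := by
        refine h.2.2.tsum_le_tsum (fun i => ?_) hs
        have : w i ^ 2 ≤ 1 := by
          rw [← sq_abs]; exact pow_le_one₀ (abs_nonneg _) (hw i)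
        nlinarith [sq_nonneg ‖F i‖]
      have h3 := h.2.1.trans_le h2
      simpa using h3)

theorem weightedShift_apply {I : Type*} {E : Type*} [NormedAddCommGroup E]
    [InnerProductSpace ℂ E] (σ : I → I) (hσ : Function.Injective σ) (w : I → ℝ)
    (hw : ∀ i, |w i| ≤ 1) (F : lp (fun _ : I => E) 2) (i : I) :
    weightedShift σ hσ w hw F (σ i) = (w i : ℂ) • F i :=
  hσ.extend_apply (fun i => (w i : ℂ) • F i) (0 : I → E) i

theorem weightedShift_apply_of_notMem {I : Type*} {E : Type*} [NormedAddCommGroup E]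
    [InnerProductSpace ℂ E] (σ : I → I) (hσ : Function.Injective σ) (w : I → ℝ)
    (hw : ∀ i, |w i| ≤ 1) (F : lp (fun _ : I => E) 2) (i : I) (hi : ¬ ∃ a, σ a = i) :
    weightedShift σ hσ w hw F i = 0 :=
  Function.extend_apply' (fun i => (w i : ℂ) • F i) (0 : I → E) i hi

theorem norm_sq_weightedShift {I : Type*} {E : Type*} [NormedAddCommGroup E]
    [InnerProductSpace ℂ E] (σ : I → I) (hσ : Function.Injective σ) (w : I → ℝ)
    (hw : ∀ i, |w i| ≤ 1) (F : lp (fun _ : I => E) 2) :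
    ‖weightedShift σ hσ w hw F‖ ^ 2 = ∑' i, w i ^ 2 * ‖F i‖ ^ 2 := by
  rw [← (hasSum_norm_extend σ hσ w hw F).2.1]
  have h : ‖weightedShift σ hσ w hw F‖ ^ 2 = ∑' i, ‖weightedShift σ hσ w hw F i‖ ^ 2 := by
    simpa using lp.norm_rpow_eq_tsum (p := 2) (by norm_num) (weightedShift σ hσ w hw F)
  exact h

/-! ### The full Fock space and the weighted right creation operators -/

/-- The full Fock space `F²(Hₙ) = ⨁_p Hₙ^{⊗p}` of an `n`-dimensional Hilbert space `Hₙ` with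
orthonormal basis `e_1, …, e_n`, in its coordinates with respect to the orthonormal basis
`e_α = e_{j_1} ⊗ ⋯ ⊗ e_{j_p}`, `α = g_{j_1} ⋯ g_{j_p} ∈ 𝔽ₙ⁺`. -/
abbrev FullFock (n : ℕ) : Type := lp (fun _ : Word n => ℂ) 2

open Classical in
/-- The basis vector `e_α` of the full Fock space. -/
def fockBasis {n : ℕ} (α : Word n) : FullFock n := lp.single 2 α (1 : ℂ)

/-- The right creation operator `R_j f = f ⊗ e_j`, that is, `R_j e_α = e_{α g_j}`. -/
def rightCreation {n : ℕ} (j : Fin n) : FullFock n →L[ℂ] FullFock n :=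
  weightedShift (fun α => α * FreeMonoid.of j) (mul_left_injective _) (fun _ => 1) (by simp)

/-- The diagonal operator `D_j e_α = √(b_α / b_{g_j α}) e_α`. -/
def diagonalD (m : ℕ) {n : ℕ} (j : Fin n) : FullFock n →L[ℂ] FullFock n :=
  weightedShift id Function.injective_id (dWeight m j) (abs_dWeight_le_one m j)

/-- The weighted right creation operator `Λ_j = R_j D_j` on the full Fock space. -/
def weightedRight (m : ℕ) {n : ℕ} (j : Fin n) : FullFock n →L[ℂ] FullFock n :=
  rightCreation j ∘L diagonalD m j

theorem weightedRight_apply (m : ℕ) {n : ℕ} (j : Fin n) (f : FullFock n) (α : Word n) :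
    weightedRight m j f (α * FreeMonoid.of j) = dWeight m j α * f α := by
  have h1 := weightedShift_apply (fun α : Word n => α * FreeMonoid.of j) (mul_left_injective _)
    (fun _ => 1) (by simp) (diagonalD m j f) α
  have h2 := weightedShift_apply id Function.injective_id (dWeight m j) (abs_dWeight_le_one m j) f α
  exact h1.trans (by simpa [diagonalD] using h2)

theorem weightedRight_apply_of_notMem (m : ℕ) {n : ℕ} (j : Fin n) (f : FullFock n) (ω : Word n)
    (h : ¬ ∃ α, α * FreeMonoid.of j = ω) : weightedRight m j f ω = 0 :=
  weightedShift_apply_of_notMem (fun α : Word n => α * FreeMonoid.of j) (mul_left_injective _)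
    (fun _ => 1) (by simp) (diagonalD m j f) ω h

/-! ### The Hilbert tensor product -/

theorem summable_tsum_pi_prod : ∀ {k : ℕ} {I : Fin k → Type} (g : ∀ s, I s → ℂ)
    (_ : ∀ s, Summable (fun i => ‖g s i‖)),
    Summable (fun γ : ∀ s, I s => ‖∏ s, g s (γ s)‖) ∧
      ∑' γ : ∀ s, I s, ∏ s, g s (γ s) = ∏ s, ∑' i, g s i
  | 0, I, g, _ => by
      refine ⟨(hasSum_fintype _).summable, ?_⟩
      rw [tsum_fintype]
      simp
  | k + 1, I, g, hg => by
      obtain ⟨ih1, ih2⟩ := summable_tsum_pi_prod (fun s : Fin k => g s.succ) (fun s => hg s.succ)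
      constructor
      · rw [← (Fin.consEquiv I).summable_iff]
        refine ((hg 0).mul_norm ih1).congr fun p => ?_
        simp [Fin.consEquiv, Fin.prod_univ_succ]
      · rw [← (Fin.consEquiv I).tsum_eq, Fin.prod_univ_succ, ← ih2,
          tsum_mul_tsum_of_summable_norm (hg 0) ih1]
        refine tsum_congr fun p => ?_
        simp [Fin.consEquiv, Fin.prod_univ_succ]

/-- The Hilbert tensor product `K ⊗ F²(H_{n₁}) ⊗ ⋯ ⊗ F²(H_{n_k})`, realized as
`ℓ²(𝔽⁺_{n₁} × ⋯ × 𝔽⁺_{n_k}; K)`. The elementary tensors are `elemTensor`; the facts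
`inner_elemTensor` and `dense_span_elemTensor` show that it is a Hilbert tensor product. -/
abbrev TensorFock (K : Type*) [NormedAddCommGroup K] {k : ℕ} (n : Fin k → ℕ) : Type _ :=
  lp (fun _ : MultiWord n => K) 2

theorem memℓp_elemTensor {K : Type*} [NormedAddCommGroup K] [InnerProductSpace ℂ K] {k : ℕ}
    {n : Fin k → ℕ} (x : K) (f : ∀ s, FullFock (n s)) :
    Memℓp (E := fun _ : MultiWord n => K) (fun γ => (∏ s, f s (γ s)) • x) 2 := by
  refine memℓp_gen ?_
  have h : ∀ s, Summable (fun i => ‖(f s i) ^ 2‖) := fun s => by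
    have := (lp.memℓp (f s)).summable (by norm_num)
    simpa using this
  have h2 := ((summable_tsum_pi_prod (fun s i => (f s i) ^ 2) h).1).mul_right (‖x‖ ^ 2)
  refine h2.congr fun γ => ?_
  simp [norm_smul, mul_pow, Finset.prod_pow]

/-- The elementary tensor `x ⊗ f₁ ⊗ ⋯ ⊗ f_k`. -/
def elemTensor {K : Type*} [NormedAddCommGroup K] [InnerProductSpace ℂ K] {k : ℕ}
    {n : Fin k → ℕ} (x : K) (f : ∀ s, FullFock (n s)) : TensorFock K n :=
  ⟨fun γ => (∏ s, f s (γ s)) • x, memℓp_elemTensor x f⟩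

theorem elemTensor_apply {K : Type*} [NormedAddCommGroup K] [InnerProductSpace ℂ K] {k : ℕ}
    {n : Fin k → ℕ} (x : K) (f : ∀ s, FullFock (n s)) (γ : MultiWord n) :
    elemTensor x f γ = (∏ s, f s (γ s)) • x := rfl

theorem inner_elemTensor {K : Type*} [NormedAddCommGroup K] [InnerProductSpace ℂ K] {k : ℕ}
    {n : Fin k → ℕ} (x y : K) (f g : ∀ s, FullFock (n s)) :
    ⟪elemTensor x f, elemTensor y g⟫_ℂ = ⟪x, y⟫_ℂ * ∏ s, ⟪f s, g s⟫_ℂ := by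
  have h := summable_tsum_pi_prod (fun s i => ⟪f s i, g s i⟫_ℂ)
    (fun s => (lp.summable_inner (𝕜 := ℂ) (f s) (g s)).norm)
  simp only [lp.inner_eq_tsum]
  rw [← h.2, ← tsum_mul_left]
  refine tsum_congr fun γ => ?_
  rw [elemTensor_apply, elemTensor_apply, inner_smul_left, inner_smul_right, map_prod]
  simp only [RCLike.inner_apply, Finset.prod_mul_distrib]
  ring

/-- The vector `x ⊗ e_γ = x ⊗ e_{γ₁} ⊗ ⋯ ⊗ e_{γ_k}`. -/
def basisTensor {K : Type*} [NormedAddCommGroup K] [InnerProductSpace ℂ K] {k : ℕ}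
    {n : Fin k → ℕ} (x : K) (γ : MultiWord n) : TensorFock K n :=
  elemTensor x (fun s => fockBasis (γ s))

open Classical in
theorem basisTensor_eq_single {K : Type*} [NormedAddCommGroup K] [InnerProductSpace ℂ K] {k : ℕ}
    {n : Fin k → ℕ} (x : K) (γ : MultiWord n) :
    basisTensor x γ = lp.single (E := fun _ : MultiWord n => K) 2 γ x := by
  apply lp.ext
  funext ω
  rw [basisTensor, elemTensor_apply]
  by_cases h : ω = γ
  · subst h
    simp [fockBasis]
  · rw [lp.single_apply_ne _ _ _ h]
    obtain ⟨s, hs⟩ := Function.ne_iff.1 h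
    rw [Finset.prod_eq_zero (Finset.mem_univ s), zero_smul]
    exact lp.single_apply_ne _ _ _ hs

theorem dense_span_elemTensor {K : Type*} [NormedAddCommGroup K] [InnerProductSpace ℂ K] {k : ℕ}
    (n : Fin k → ℕ) :
    Dense (Submodule.span ℂ
      {F : TensorFock K n | ∃ (x : K) (f : ∀ s, FullFock (n s)), F = elemTensor x f} :
        Set (TensorFock K n)) := by
  classical
  intro F
  refine mem_closure_of_tendsto (lp.hasSum_single (by norm_num) F)
    (Filter.Eventually.of_forall fun S => ?_)
  refine Submodule.sum_mem _ fun γ _ => Submodule.subset_span ⟨F γ, fun s => fockBasis (γ s), ?_⟩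
  exact (basisTensor_eq_single (F γ) γ).symm

/-! ### The operators `I_K ⊗ Λ_{i,j}` -/

theorem update_mul_injective {k : ℕ} {n : Fin k → ℕ} (i : Fin k) (β : Word (n i)) :
    Function.Injective (fun γ : MultiWord n => Function.update γ i (γ i * β)) := by
  intro γ δ h
  funext s
  have hs := congrFun h s
  by_cases hsi : s = i
  · subst hsi
    simpa using hs
  · simpa [hsi] using hs

/-- The operator `I_K ⊗ I ⊗ ⋯ ⊗ Λ_{i,j} ⊗ ⋯ ⊗ I` on `K ⊗ F²(H_{n₁}) ⊗ ⋯ ⊗ F²(H_{n_k})`, with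
`Λ_{i,j}` acting on the `i`-th Fock space; see `bigLambda_elemTensor`. -/
def bigLambda (K : Type*) [NormedAddCommGroup K] [InnerProductSpace ℂ K] {k : ℕ} {n : Fin k → ℕ}
    (m : Fin k → ℕ) (i : Fin k) (j : Fin (n i)) : TensorFock K n →L[ℂ] TensorFock K n :=
  weightedShift (fun γ => Function.update γ i (γ i * FreeMonoid.of j)) (update_mul_injective i _)
    (fun γ => dWeight (m i) j (γ i)) (fun γ => abs_dWeight_le_one (m i) j (γ i))

/-- `bigLambda` is the amplification of `Λ_{i,j}` to the tensor product. -/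
theorem bigLambda_elemTensor {K : Type*} [NormedAddCommGroup K] [InnerProductSpace ℂ K] {k : ℕ}
    {n : Fin k → ℕ} (m : Fin k → ℕ) (i : Fin k) (j : Fin (n i)) (x : K)
    (f : ∀ s, FullFock (n s)) :
    bigLambda K m i j (elemTensor x f)
      = elemTensor x (Function.update f i (weightedRight (m i) j (f i))) := by
  apply lp.ext
  funext ω
  have hrest : ∀ (γ : MultiWord n) (v : Word (n i)) (g : FullFock (n i)),
      ∏ s, (Function.update f i g s) (Function.update γ i v s)
        = g v * ∏ s ∈ Finset.univ.erase i, f s (γ s) := by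
    intro γ v g
    rw [← Finset.mul_prod_erase _ _ (Finset.mem_univ i)]
    congr 1
    · simp
    · refine Finset.prod_congr rfl fun s hs => ?_
      have hsi := Finset.ne_of_mem_erase hs
      simp [hsi]
  rw [elemTensor_apply]
  by_cases h : ∃ γ : MultiWord n, Function.update γ i (γ i * FreeMonoid.of j) = ω
  · obtain ⟨γ, rfl⟩ := h
    have h1 := weightedShift_apply (E := K)
      (fun γ : MultiWord n => Function.update γ i (γ i * FreeMonoid.of j))
      (update_mul_injective i _) (fun γ => dWeight (m i) j (γ i))
      (fun γ => abs_dWeight_le_one (m i) j (γ i)) (elemTensor x f) γ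
    have h2 := hrest γ (γ i) (f i)
    rw [Function.update_eq_self, Function.update_eq_self] at h2
    rw [hrest, weightedRight_apply, mul_assoc, ← h2, mul_smul]
    exact h1
  · have h1 := weightedShift_apply_of_notMem (E := K)
      (fun γ : MultiWord n => Function.update γ i (γ i * FreeMonoid.of j))
      (update_mul_injective i _) (fun γ => dWeight (m i) j (γ i))
      (fun γ => abs_dWeight_le_one (m i) j (γ i)) (elemTensor x f) ω h
    have h2 : ¬ ∃ α, α * FreeMonoid.of j = ω i := by
      rintro ⟨α, hα⟩
      refine h ⟨Function.update ω i α, ?_⟩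
      simp [hα]
    have h3 := hrest ω (ω i) (weightedRight (m i) j (f i))
    rw [Function.update_eq_self] at h3
    rw [h3, weightedRight_apply_of_notMem _ _ _ _ h2, zero_mul, zero_smul]
    exact h1

/-- The product `Λ_{i,β} = Λ_{i,j_1} ⋯ Λ_{i,j_p}` for `β = g_{j_1} ⋯ g_{j_p}` (amplified by `I_K`),
with `Λ_{i,g₀} = I`. -/
def bigLambdaWord (K : Type*) [NormedAddCommGroup K] [InnerProductSpace ℂ K] {k : ℕ}
    {n : Fin k → ℕ} (m : Fin k → ℕ) (i : Fin k) :
    Word (n i) →* (TensorFock K n →L[ℂ] TensorFock K n) :=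
  FreeMonoid.lift (bigLambda K m i)

/-! ### Row operators, diagonal operators and Cauchy duals -/

/-- The Hilbert space `H^{(n)}`, the direct sum of `n` copies of `H`. -/
abbrev Copies (n : ℕ) (H : Type*) : Type _ := PiLp 2 (fun _ : Fin n => H)

/-- The row operator `[L_1 ⋯ L_n] : H^{(n)} → H`. -/
def rowOp {n : ℕ} {H : Type*} [NormedAddCommGroup H] [InnerProductSpace ℂ H]
    (L : Fin n → H →L[ℂ] H) : Copies n H →L[ℂ] H :=
  ∑ j, L j ∘L PiLp.proj 2 (fun _ : Fin n => H) j

/-- The operator `diag_n(A)` on `H^{(n)}`, the direct sum of `n` copies of `A`. -/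
def diagOp (n : ℕ) {H : Type*} [NormedAddCommGroup H] [InnerProductSpace ℂ H]
    (A : H →L[ℂ] H) : Copies n H →L[ℂ] Copies n H :=
  ((PiLp.continuousLinearEquiv 2 ℂ (fun _ : Fin n => H)).symm : _ →L[ℂ] Copies n H) ∘L
    ContinuousLinearMap.pi (fun j => A ∘L PiLp.proj 2 (fun _ : Fin n => H) j)

/-- The Cauchy dual `L' = L (L* L)⁻¹` of an operator `L` for which `L* L` is invertible. -/
def cauchyDual {G H : Type*} [NormedAddCommGroup G] [InnerProductSpace ℂ G] [CompleteSpace G]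
    [NormedAddCommGroup H] [InnerProductSpace ℂ H] [CompleteSpace H] (L : G →L[ℂ] H) : G →L[ℂ] H :=
  L ∘L Ring.inverse (ContinuousLinearMap.adjoint L ∘L L)

/-- The row operator `[I_K ⊗ Λ_{i,1} ⋯ I_K ⊗ Λ_{i,n_i}]`. -/
def lambdaRow (K : Type*) [NormedAddCommGroup K] [InnerProductSpace ℂ K] {k : ℕ} {n : Fin k → ℕ}
    (m : Fin k → ℕ) (i : Fin k) : Copies (n i) (TensorFock K n) →L[ℂ] TensorFock K n :=
  rowOp (bigLambda K m i)

theorem norm_sq_bigLambda_ge {K : Type*} [NormedAddCommGroup K] [InnerProductSpace ℂ K] {k : ℕ}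
    {n : Fin k → ℕ} (m : Fin k → ℕ) (i : Fin k) (hm : 1 ≤ m i) (j : Fin (n i))
    (F : TensorFock K n) : ‖F‖ ^ 2 * (m i : ℝ)⁻¹ ≤ ‖bigLambda K m i j F‖ ^ 2 := by
  unfold bigLambda
  rw [norm_sq_weightedShift]
  have h0 : ‖F‖ ^ 2 = ∑' γ, ‖F γ‖ ^ 2 := by
    simpa using lp.norm_rpow_eq_tsum (p := 2) (by norm_num) F
  have hs : Summable (fun γ => ‖F γ‖ ^ 2) := by
    simpa using (lp.memℓp F).summable (by norm_num)
  rw [h0, ← tsum_mul_right]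
  refine (hs.mul_right _).tsum_le_tsum (fun γ => ?_)
    (hasSum_norm_extend _ (update_mul_injective i (FreeMonoid.of j))
      (fun γ => dWeight (m i) j (γ i)) (fun γ => abs_dWeight_le_one (m i) j (γ i)) F).2.2
  rw [mul_comm]
  refine mul_le_mul_of_nonneg_right ?_ (sq_nonneg _)
  rw [dWeight_sq hm]
  have hm' : (1 : ℝ) ≤ m i := by exact_mod_cast hm
  have hl : (0 : ℝ) ≤ (γ i).length := Nat.cast_nonneg _
  rw [inv_eq_one_div, div_le_div_iff₀ (by linarith) (by linarith)]
  nlinarith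

theorem inner_bigLambda_of_ne {K : Type*} [NormedAddCommGroup K] [InnerProductSpace ℂ K] {k : ℕ}
    {n : Fin k → ℕ} (m : Fin k → ℕ) (i : Fin k) {j l : Fin (n i)} (hjl : j ≠ l)
    (F G : TensorFock K n) : ⟪bigLambda K m i j F, bigLambda K m i l G⟫_ℂ = 0 := by
  rw [lp.inner_eq_tsum]
  refine (tsum_congr fun ω => ?_).trans tsum_zero
  by_cases h : ∃ γ : MultiWord n, Function.update γ i (γ i * FreeMonoid.of j) = ω
  · have h' : ¬ ∃ γ : MultiWord n, Function.update γ i (γ i * FreeMonoid.of l) = ω := by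
      rintro ⟨δ, hδ⟩
      obtain ⟨γ, hγ⟩ := h
      have e := congrFun (hγ.trans hδ.symm) i
      simp only [Function.update_self] at e
      have e2 := congrArg FreeMonoid.reverse e
      simp only [FreeMonoid.reverse_mul] at e2
      exact hjl (by simpa using congrArg (fun w => (FreeMonoid.toList w).head?) e2)
    have h1 : bigLambda K m i l G ω = 0 := weightedShift_apply_of_notMem _ _ _ _ G ω h'
    rw [h1, inner_zero_right]
  · have h1 : bigLambda K m i j F ω = 0 := weightedShift_apply_of_notMem _ _ _ _ F ω h
    rw [h1, inner_zero_left]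

/-- `Λ_i* Λ_i` is invertible, so that the inverse in the Cauchy dual of `Λ_i` is a true inverse. -/
theorem isUnit_adjoint_lambdaRow_comp {K : Type*} [NormedAddCommGroup K] [InnerProductSpace ℂ K]
    [CompleteSpace K] {k : ℕ} {n : Fin k → ℕ} (m : Fin k → ℕ) (i : Fin k) (hm : 1 ≤ m i) :
    IsUnit (ContinuousLinearMap.adjoint (lambdaRow K (n := n) m i) ∘L
      lambdaRow K (n := n) m i) := by
  have hc : (0 : NNReal) < (m i : NNReal)⁻¹ := by
    have : (0 : NNReal) < m i := by exact_mod_cast hm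
    positivity
  refine ContinuousLinearMap.isUnit_of_forall_le_norm_inner_map _ hc fun F => ?_
  rw [ContinuousLinearMap.comp_apply, ContinuousLinearMap.adjoint_inner_left,
    inner_self_eq_norm_sq_to_K, norm_pow, RCLike.norm_ofReal, abs_norm]
  have h1 : ((‖lambdaRow K (n := n) m i F‖ ^ 2 : ℝ) : ℂ)
      = ((∑ j, ‖bigLambda K m i j (F j)‖ ^ 2 : ℝ) : ℂ) := by
    have e : lambdaRow K (n := n) m i F = ∑ j, bigLambda K m i j (F j) := by
      simp [lambdaRow, rowOp]
    have := inner_self_eq_norm_sq_to_K (𝕜 := ℂ) (lambdaRow K (n := n) m i F)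
    push_cast
    refine Eq.trans this.symm ?_
    rw [e, sum_inner]
    refine Finset.sum_congr rfl fun j _ => ?_
    rw [inner_sum, Finset.sum_eq_single j]
    · exact inner_self_eq_norm_sq_to_K (𝕜 := ℂ) _
    · intro l _ hl
      exact inner_bigLambda_of_ne m i hl.symm _ _
    · simp
  have h2 := Complex.ofReal_injective h1
  rw [h2, PiLp.norm_sq_eq_of_L2, Finset.sum_mul]
  refine Finset.sum_le_sum fun j _ => ?_
  simpa using norm_sq_bigLambda_ge m i hm j (F j)

/-! ### The Brown–Halmos condition -/

/-- The Brown–Halmos condition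
`Λ_i'* T Λ_i' = diag_{n_i}(∑_{j=0}^{m_i-1} (-1)^j binom(m_i, j+1) ∑_{|β|=j} Λ_{i,β} T Λ_{i,β}*)`
for every `i`, with all operators amplified by `I_K`. The words `β` of length `j` are enumerated by
the maps `Fin j → Fin (n i)`. -/
def BrownHalmos {K : Type*} [NormedAddCommGroup K] [InnerProductSpace ℂ K] [CompleteSpace K]
    {k : ℕ} {n : Fin k → ℕ} (m : Fin k → ℕ) (T : TensorFock K n →L[ℂ] TensorFock K n) : Prop :=
  ∀ i : Fin k,
    ContinuousLinearMap.adjoint (cauchyDual (lambdaRow K (n := n) m i)) ∘L T ∘L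
        cauchyDual (lambdaRow K (n := n) m i)
      = diagOp (n i) (∑ j ∈ Finset.range (m i), ((-1 : ℂ) ^ j * ((m i).choose (j + 1) : ℂ)) •
          ∑ β : Fin j → Fin (n i),
            bigLambdaWord K m i (FreeMonoid.ofList (List.ofFn β)) ∘L T ∘L
              ContinuousLinearMap.adjoint
                (bigLambdaWord K m i (FreeMonoid.ofList (List.ofFn β))))

/-! ### Comparable words and weighted multi-Toeplitz operators -/

/-- `ω ≥_r γ`: there is `σ` with `ω = σ γ`. -/
def RightGE {n : ℕ} (ω γ : Word n) : Prop := ∃ σ, ω = σ * γ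

/-- `ω >_r γ`: there is `σ ≠ g₀` with `ω = σ γ`. -/
def RightGT {n : ℕ} (ω γ : Word n) : Prop := ∃ σ, σ ≠ 1 ∧ ω = σ * γ

open Classical in
/-- The right quotient `ω \_r γ`, that is the word `σ` with `ω = σ γ`, if `ω ≥_r γ`; the empty word
`g₀` otherwise. -/
def rightQuot {n : ℕ} (ω γ : Word n) : Word n := if h : RightGE ω γ then h.choose else 1

theorem rightQuot_mul {n : ℕ} (σ γ : Word n) : rightQuot (σ * γ) γ = σ := by
  have h : RightGE (σ * γ) γ := ⟨σ, rfl⟩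
  rw [rightQuot, dif_pos h]
  exact (mul_right_cancel h.choose_spec).symm

theorem rightQuot_of_not {n : ℕ} {ω γ : Word n} (h : ¬ RightGE ω γ) : rightQuot ω γ = 1 := by
  rw [rightQuot, dif_neg h]

/-- The set `𝒞` of comparable pairs of multi-words. -/
def comparablePairs {k : ℕ} (n : Fin k → ℕ) : Set (MultiWord n × MultiWord n) :=
  {p | ∀ i, RightGT (p.2 i) (p.1 i) ∨ RightGT (p.1 i) (p.2 i) ∨ p.1 i = p.2 i}

/-- The set `𝒥` of pairs `(σ, β)` with `|σ_i| = s_i⁺` and `|β_i| = s_i⁻` for some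
`s_1, …, s_k ∈ ℤ`. -/
def reducedPairs {k : ℕ} (n : Fin k → ℕ) : Set (MultiWord n × MultiWord n) :=
  {p | ∃ s : Fin k → ℤ, ∀ i,
    ((p.1 i).length : ℤ) = max (s i) 0 ∧ ((p.2 i).length : ℤ) = max (-s i) 0}

theorem simplification_mem {k : ℕ} {n : Fin k → ℕ} {p : MultiWord n × MultiWord n} :
    ((fun i => rightQuot (p.1 i) (p.2 i), fun i => rightQuot (p.2 i) (p.1 i)) :
      MultiWord n × MultiWord n) ∈ reducedPairs n := by
  have key : ∀ (m : ℕ) (u v : Word m), rightQuot u v = 1 ∨ rightQuot v u = 1 := by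
    intro m u v
    by_cases h : RightGE u v
    · by_cases h' : RightGE v u
      · obtain ⟨σ, hσ⟩ := h
        obtain ⟨τ, hτ⟩ := h'
        have e1 := congrArg FreeMonoid.length hσ
        have e2 := congrArg FreeMonoid.length hτ
        rw [FreeMonoid.length_mul] at e1 e2
        have : σ = 1 := FreeMonoid.length_eq_zero.1 (by omega)
        left
        rw [hσ, rightQuot_mul, this]
      · exact Or.inr (rightQuot_of_not h')
    · exact Or.inl (rightQuot_of_not h)
  refine ⟨fun i => ((rightQuot (p.1 i) (p.2 i)).length : ℤ) - (rightQuot (p.2 i) (p.1 i)).length,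
    fun i => ?_⟩
  rcases key _ (p.1 i) (p.2 i) with h | h
  · simp [h]
  · simp [h]

/-- The simplification function `𝐬 : 𝒞 → 𝒥`, `(ω, γ) ↦ (ω \_r γ, γ \_r ω)` (componentwise, with the
convention that the quotient is `g₀` where the two words are not in that order). -/
def simplification {k : ℕ} {n : Fin k → ℕ} (p : comparablePairs n) : reducedPairs n :=
  ⟨(fun i => rightQuot (p.1.1 i) (p.1.2 i), fun i => rightQuot (p.1.2 i) (p.1.1 i)),
    simplification_mem⟩

open Classical in
/-- The minimum of two comparable words with respect to `≤_r`. -/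
def wordMin {n : ℕ} (ω γ : Word n) : Word n := if RightGE ω γ then γ else ω

open Classical in
/-- The maximum of two comparable words with respect to `≤_r`. -/
def wordMax {n : ℕ} (ω γ : Word n) : Word n := if RightGE ω γ then ω else γ

/-- The weight `τ_{(ω,γ)} = ∏_i √(b_{min{ω_i,γ_i}} / b_{max{ω_i,γ_i}})` of a comparable pair. -/
def tau {k : ℕ} {n : Fin k → ℕ} (m : Fin k → ℕ) (ω γ : MultiWord n) : ℝ :=
  ∏ i, Real.sqrt (b (m i) (wordMin (ω i) (γ i)) / b (m i) (wordMax (ω i) (γ i)))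

/-- Weighted (right) multi-Toeplitz operators. In Mathlib the inner product `⟪u, v⟫_ℂ` is linear in
`v`, so that `⟨T(x ⊗ e_γ), y ⊗ e_ω⟩` (linear in the first variable) is
`⟪y ⊗ e_ω, T(x ⊗ e_γ)⟫_ℂ`. -/
def IsWeightedMultiToeplitz {K : Type*} [NormedAddCommGroup K] [InnerProductSpace ℂ K] {k : ℕ}
    {n : Fin k → ℕ} (m : Fin k → ℕ) (T : TensorFock K n →L[ℂ] TensorFock K n) : Prop :=
  ∃ A : reducedPairs n → K →L[ℂ] K, ∀ (ω γ : MultiWord n) (x y : K),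
    (∀ h : (ω, γ) ∈ comparablePairs n,
      ⟪basisTensor y ω, T (basisTensor x γ)⟫_ℂ
        = (tau m ω γ : ℂ) * ⟪y, A (simplification ⟨(ω, γ), h⟩) x⟫_ℂ) ∧
    ((ω, γ) ∉ comparablePairs n → ⟪basisTensor y ω, T (basisTensor x γ)⟫_ℂ = 0)

end PolyHyperball

end

/-!
Write `T[ω, γ]` for the matrix entries of `T` and pass to the scaled entries
`U[ω, γ] = ∏_s √(b_{ω_s} b_{γ_s}) T[ω, γ]` (`scaledEntry`).

*Brown–Halmos side.* The Cauchy dual of `Λ_i` is the weighted shift with the inverse weights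
(`cauchyDual_lambdaRow_single`), so that the left side of the condition at `((l, ω), (j, γ))` is, after
scaling, the entry `U[ω g_l, γ g_j]`. The inner sum over `|β| = p` on the right side is the `p`-th
iterate of `S ↦ ∑_j Λ_{i,j} S Λ_{i,j}*` (`sum_bigLambdaWord_conj`), which acts on scaled entries as
the shift `Φ` that removes a common last letter of the `i`-th components (`entryArray_conjShift`).
The alternating sum of binomial coefficients is the one in
`(1 - Φ)^m = 1 - Φ ∑_{p < m} (-1)^p binom(m, p + 1) Φ^p`, so the condition for `i` says that
`(1 - Φ)^{m_i} U` agrees with `U` where one of the `i`-th components is empty, and vanishes elsewhere.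

*Inverting.* The shift `Φ` is locally nilpotent, hence this is equivalent to
`U = ∑_q binom(q + m_i - 1, q) Φ^q (U restricted to that boundary)`
(`isToeplitzArray_self_iff`). Explicitly: `U[σq, βq] = b_q U[σ, β]` in the `i`-th component if `σ` or `β`
is empty, and `U` vanishes at pairs whose `i`-th components are not comparable.

*Toeplitz side.* Since `τ_{(ω,γ)} ∏_s √(b_{ω_s} b_{γ_s}) = ∏_s b_{min(ω_s, γ_s)}`, the multi-Toeplitz
property says that `U[ω, γ] = ∏_s b_{min(ω_s, γ_s)} A_{𝐬(ω,γ)}` at comparable pairs and `U[ω, γ] = 0`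
otherwise. This is the conjunction over `i` of the previous description: the common right factors
are split off one coordinate at a time (`eq_prod_mul_of_appendAt`), and `A_{(σ;β)} = U[σ, β]`.
-/

noncomputable section

namespace PolyHyperball

/-! ### Toeplitz arrays and the diagonal shift -/

/-- The shift `Φ` along the diagonal direction of an array indexed by pairs of lists:
`(Φ f)(a :: u, c :: v)` is `f(u, v)` if `a = c` and `0` otherwise, and `Φ f` vanishes at the pairs in
which one list is empty. -/
def diagShift (α : Type*) [DecidableEq α] :
    (List α → List α → ℂ) →ₗ[ℂ] (List α → List α → ℂ) where
  toFun f := fun u v => match u, v with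
    | a :: u, c :: v => if a = c then f u v else 0
    | _, _ => 0
  map_add' f g := by
    funext u v
    rcases u with _ | ⟨a, u⟩ <;> rcases v with _ | ⟨c, v⟩ <;> simp
    split_ifs <;> simp
  map_smul' z f := by
    funext u v
    rcases u with _ | ⟨a, u⟩ <;> rcases v with _ | ⟨c, v⟩ <;> simp

section Core
variable {α : Type*} [DecidableEq α]

@[simp] theorem diagShift_cons (f : List α → List α → ℂ) (a c : α) (u v : List α) :
    diagShift α f (a :: u) (c :: v) = if a = c then f u v else 0 := rfl

theorem diagShift_of_nil (f : List α → List α → ℂ) {u v : List α} (h : u = [] ∨ v = []) :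
    diagShift α f u v = 0 := by
  rcases h with rfl | rfl
  · rfl
  · cases u <;> rfl

/-- The array `f` is the Toeplitz array of order `r` with boundary values `h`: its entry at
`(q ++ u, q ++ v)`, with `u` or `v` empty, is the coefficient `binom(|q| + r - 1, |q|)` of `x ^ |q|` in
`(1 - x)⁻ʳ` times `h(u, v)`, and its entries at pairs that are not prefix-comparable are zero. Only
the values of `h` at pairs with an empty member matter. With `Nat.multichoose` the case `r = 0` is
meaningful: `f` is then supported at the pairs with an empty member. -/
def IsToeplitzArray (r : ℕ) (f h : List α → List α → ℂ) : Prop :=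
  (∀ q u v, (u = [] ∨ v = []) → f (q ++ u) (q ++ v) = (r.multichoose q.length : ℂ) * h u v) ∧
    ∀ u v, ¬ u <+: v → ¬ v <+: u → f u v = 0

theorem isToeplitzArray_zero_iff (f h : List α → List α → ℂ) :
    IsToeplitzArray 0 f h ↔
      (∀ u v, (u = [] ∨ v = []) → f u v = h u v) ∧ ∀ a u c v, f (a :: u) (c :: v) = 0 := by
  constructor
  · rintro ⟨h1, h2⟩
    have key : ∀ q u v, (u = [] ∨ v = []) → q ≠ [] → f (q ++ u) (q ++ v) = 0 := by
      intro q u v huv hq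
      obtain ⟨a, q, rfl⟩ := List.exists_cons_of_ne_nil hq
      rw [h1 _ u v huv]
      simp
    refine ⟨fun u v huv => by simpa using h1 [] u v huv, fun a u c v => ?_⟩
    by_cases h3 : (a :: u) <+: (c :: v)
    · obtain ⟨t, ht⟩ := h3
      simpa [ht] using key (a :: u) [] t (Or.inl rfl) (by simp)
    · by_cases h4 : (c :: v) <+: (a :: u)
      · obtain ⟨t, ht⟩ := h4
        simpa [ht] using key (c :: v) t [] (Or.inr rfl) (by simp)
      · exact h2 _ _ h3 h4
  · rintro ⟨h1, h2⟩
    refine ⟨fun q u v huv => ?_, fun u v h3 h4 => ?_⟩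
    · rcases q with _ | ⟨a, q⟩
      · simpa using h1 u v huv
      · simpa using h2 a (q ++ u) a (q ++ v)
    · rcases u with _ | ⟨a, u⟩
      · simp at h3
      · rcases v with _ | ⟨c, v⟩
        · simp at h4
        · exact h2 ..

/-- Applying `1 - Φ` lowers the order by one; this is Pascal's rule
`multichoose (r + 1) (q + 1) = multichoose r (q + 1) + multichoose (r + 1) q`. The direction from
right to left is an induction on lists, which replaces the inversion of `1 - Φ`. -/
theorem isToeplitzArray_succ_iff (r : ℕ) (f h : List α → List α → ℂ) :
    IsToeplitzArray (r + 1) f h ↔ IsToeplitzArray r ((1 - diagShift α) f) h := by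
  have e : ∀ u v, (1 - diagShift α) f u v = f u v - diagShift α f u v := fun _ _ => rfl
  constructor
  · rintro ⟨h1, h2⟩
    refine ⟨fun q u v huv => ?_, fun u v h3 h4 => ?_⟩
    · rw [e, h1 q u v huv]
      rcases q with _ | ⟨a, q⟩
      · simp [diagShift_of_nil f huv]
      · rw [List.cons_append, List.cons_append, diagShift_cons, if_pos rfl, h1 q u v huv,
          List.length_cons, Nat.multichoose_succ_succ]
        push_cast
        ring
    · rw [e, h2 u v h3 h4]
      rcases u with _ | ⟨a, u⟩
      · simp at h3
      · rcases v with _ | ⟨c, v⟩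
        · simp at h4
        · rw [diagShift_cons]
          split_ifs with hac
          · subst hac
            rw [h2 u v (by simpa using h3) (by simpa using h4), sub_zero]
          · simp
  · rintro ⟨h1, h2⟩
    refine ⟨fun q u v huv => ?_, fun u => ?_⟩
    · induction q with
      | nil => simpa [e, diagShift_of_nil f huv] using h1 [] u v huv
      | cons a q ih =>
        have := h1 (a :: q) u v huv
        rw [e, List.cons_append, List.cons_append, diagShift_cons, if_pos rfl, ih,
          sub_eq_iff_eq_add] at this
        rw [List.cons_append, List.cons_append, this, List.length_cons, Nat.multichoose_succ_succ]
        push_cast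
        ring
    · induction u with
      | nil => simp
      | cons a u ih =>
        intro v h3 h4
        rcases v with _ | ⟨c, v⟩
        · simp at h4
        · have := h2 _ _ h3 h4
          rw [e, diagShift_cons, sub_eq_zero] at this
          rw [this]
          split_ifs with hac
          · subst hac
            exact ih v (by simpa using h3) (by simpa using h4)
          · rfl

theorem isToeplitzArray_iff_pow (r : ℕ) (f h : List α → List α → ℂ) :
    IsToeplitzArray r f h ↔ IsToeplitzArray 0 (((1 - diagShift α) ^ r) f) h := by
  induction r generalizing f with
  | zero => simp
  | succ r ih => rw [isToeplitzArray_succ_iff, ih, pow_succ]; rfl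

theorem one_sub_pow_eq {R : Type*} [Ring R] [Algebra ℂ R] (Φ : R) (r : ℕ) :
    (1 - Φ) ^ r =
      1 - Φ * ∑ p ∈ Finset.range r, ((-1 : ℂ) ^ p * (r.choose (p + 1) : ℂ)) • Φ ^ p := by
  have h : 1 - Φ = (-1 : ℂ) • Φ + 1 := by rw [neg_one_smul, neg_add_eq_sub]
  rw [h, (Commute.one_right _).add_pow, Finset.sum_range_succ', Finset.mul_sum, add_comm,
    sub_eq_add_neg, ← Finset.sum_neg_distrib]
  simp only [one_pow, mul_one, pow_zero, Nat.choose_zero_right, Nat.cast_one]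
  congr 1
  refine Finset.sum_congr rfl fun p _ => ?_
  rw [mul_smul_comm, ← pow_succ', smul_pow, ← Nat.cast_comm, ← nsmul_eq_mul,
    ← Nat.cast_smul_eq_nsmul ℂ, smul_smul, ← neg_smul]
  congr 1
  ring

/-- An array is Toeplitz of order `r` with its own boundary values if and only if it satisfies the
recursion which expresses `(1 - Φ)ʳ f = f` on the boundary and `(1 - Φ)ʳ f = 0` off the boundary. -/
theorem isToeplitzArray_self_iff (r : ℕ) (f : List α → List α → ℂ) :
    IsToeplitzArray r f f ↔ ∀ a u c v, f (a :: u) (c :: v) =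
      if a = c then ∑ p ∈ Finset.range r, ((-1 : ℂ) ^ p * (r.choose (p + 1) : ℂ)) *
        ((diagShift α ^ p) f) u v else 0 := by
  have e : ∀ u v, ((1 - diagShift α) ^ r) f u v = f u v - diagShift α
      (∑ p ∈ Finset.range r, ((-1 : ℂ) ^ p * (r.choose (p + 1) : ℂ)) • (diagShift α ^ p) f) u v := by
    intro u v
    rw [one_sub_pow_eq]
    simp
  rw [isToeplitzArray_iff_pow, isToeplitzArray_zero_iff, and_iff_right]
  · simp only [e, diagShift_cons, sub_eq_zero, Finset.sum_apply, Pi.smul_apply, smul_eq_mul]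
  · intro u v huv
    rw [e, diagShift_of_nil _ huv, sub_zero]

end Core

/-! ### The weighted shifts and the Cauchy dual on basis vectors -/

section Basis
variable {K : Type*} [NormedAddCommGroup K] [InnerProductSpace ℂ K] {k : ℕ} {n : Fin k → ℕ}

/-- The multi-word `γ` with `q` appended on the right of its `i`-th component. -/
abbrev appendAt (i : Fin k) (q : Word (n i)) (γ : MultiWord n) : MultiWord n :=
  Function.update γ i (γ i * q)

theorem inner_basisTensor_left (y : K) (ω : MultiWord n) (F : TensorFock K n) :
    ⟪basisTensor y ω, F⟫_ℂ = ⟪y, F ω⟫_ℂ := by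
  classical
  rw [basisTensor_eq_single, lp.inner_single_left]

theorem inner_basisTensor_right (x : K) (γ : MultiWord n) (F : TensorFock K n) :
    ⟪F, basisTensor x γ⟫_ℂ = ⟪F γ, x⟫_ℂ := by
  classical
  rw [basisTensor_eq_single, lp.inner_single_right]

theorem ext_basisTensor {A B : TensorFock K n →L[ℂ] TensorFock K n}
    (h : ∀ (ω γ : MultiWord n) (x y : K),
      ⟪basisTensor y ω, A (basisTensor x γ)⟫_ℂ = ⟪basisTensor y ω, B (basisTensor x γ)⟫_ℂ) :
    A = B := by
  classical
  refine lp.ext_continuousLinearMap (by norm_num) fun γ => ?_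
  ext x ω
  refine ext_inner_left ℂ fun y => ?_
  have := h ω γ x y
  rw [inner_basisTensor_left, inner_basisTensor_left, basisTensor_eq_single] at this
  exact this

theorem inner_single_copies_left {r : ℕ} {H : Type*} [NormedAddCommGroup H] [InnerProductSpace ℂ H]
    (l : Fin r) (f : H) (G : Copies r H) : ⟪PiLp.single 2 l f, G⟫_ℂ = ⟪f, G l⟫_ℂ := by
  rw [PiLp.inner_apply, Finset.sum_eq_single l]
  · simp
  · intro j _ hj
    simp [hj]
  · simp

theorem inner_single_copies_right {r : ℕ} {H : Type*} [NormedAddCommGroup H]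
    [InnerProductSpace ℂ H] (l : Fin r) (f : H) (G : Copies r H) :
    ⟪G, PiLp.single 2 l f⟫_ℂ = ⟪G l, f⟫_ℂ := by
  rw [← inner_conj_symm, inner_single_copies_left, inner_conj_symm]

theorem diagOp_single_apply {r : ℕ} {H : Type*} [NormedAddCommGroup H] [InnerProductSpace ℂ H]
    (A : H →L[ℂ] H) (l j : Fin r) (f : H) :
    diagOp r A (PiLp.single 2 j f) l = if l = j then A f else 0 := by
  have h : diagOp r A (PiLp.single 2 j f) l =
      A ((PiLp.single 2 j f : PiLp 2 fun _ : Fin r => H) l) := rfl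
  rw [h]
  split_ifs with hlj
  · rw [hlj, PiLp.single_eq_same]
  · rw [PiLp.single_eq_of_ne _ hlj, map_zero]

theorem lambdaRow_apply (m : Fin k → ℕ) (i : Fin k) (G : Copies (n i) (TensorFock K n)) :
    lambdaRow K (n := n) m i G = ∑ j, bigLambda K m i j (G j) := by
  simp [lambdaRow, rowOp]

theorem lambdaRow_single (m : Fin k → ℕ) (i : Fin k) (j : Fin (n i)) (F : TensorFock K n) :
    lambdaRow K (n := n) m i (PiLp.single 2 j F) = bigLambda K m i j F := by
  rw [lambdaRow_apply, Finset.sum_eq_single j]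
  · simp
  · intro l _ hl
    simp [hl]
  · simp

/-- Operators on `n` copies of the tensor product are determined by their matrix entries. -/
theorem ext_single_basisTensor_iff {r : ℕ}
    {A B : Copies r (TensorFock K n) →L[ℂ] Copies r (TensorFock K n)} :
    A = B ↔ ∀ (l j : Fin r) (ω γ : MultiWord n) (x y : K),
      ⟪PiLp.single 2 l (basisTensor y ω), A (PiLp.single 2 j (basisTensor x γ))⟫_ℂ =
        ⟪PiLp.single 2 l (basisTensor y ω), B (PiLp.single 2 j (basisTensor x γ))⟫_ℂ := by
  refine ⟨fun h _ _ _ _ _ _ => by rw [h], fun h => ?_⟩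
  let ι : Fin r → TensorFock K n →L[ℂ] Copies r (TensorFock K n) := fun j =>
    ((PiLp.continuousLinearEquiv 2 ℂ (fun _ : Fin r => TensorFock K n)).symm :
      _ →L[ℂ] Copies r (TensorFock K n)) ∘L
      ContinuousLinearMap.single ℂ (fun _ : Fin r => TensorFock K n) j
  have hblock : ∀ l j, PiLp.proj 2 (fun _ : Fin r => TensorFock K n) l ∘L A ∘L ι j =
      PiLp.proj 2 (fun _ : Fin r => TensorFock K n) l ∘L B ∘L ι j := fun l j =>
    ext_basisTensor fun ω γ x y => by
      have := h l j ω γ x y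
      rw [inner_single_copies_left, inner_single_copies_left] at this
      exact this
  ext1 G
  have hG : G = ∑ j, ι j (G j) := by
    refine PiLp.ext fun l => ?_
    rw [WithLp.ofLp_sum, Finset.sum_apply, Finset.sum_eq_single l]
    · exact (PiLp.single_eq_same (β := fun _ : Fin r => TensorFock K n) 2 l (G l)).symm
    · intro j _ hj
      exact PiLp.single_eq_of_ne (β := fun _ : Fin r => TensorFock K n) 2 hj.symm (G j)
    · simp
  rw [hG, map_sum, map_sum]
  refine Finset.sum_congr rfl fun j _ => PiLp.ext fun l => ?_
  exact congrArg (fun C => C (G j)) (hblock l j)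

theorem bigLambda_basisTensor (m : Fin k → ℕ) (i : Fin k) (j : Fin (n i)) (x : K)
    (γ : MultiWord n) :
    bigLambda K m i j (basisTensor x γ) =
      (dWeight (m i) j (γ i) : ℂ) • basisTensor x (appendAt i (FreeMonoid.of j) γ) := by
  classical
  apply lp.ext
  funext ω
  rw [lp.coeFn_smul, Pi.smul_apply, basisTensor_eq_single, basisTensor_eq_single]
  by_cases h : ∃ δ : MultiWord n, appendAt i (FreeMonoid.of j) δ = ω
  · obtain ⟨δ, rfl⟩ := h
    refine (weightedShift_apply _ (update_mul_injective i _) _ _ _ δ).trans ?_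
    by_cases hδ : δ = γ
    · subst hδ
      rw [lp.single_apply_self, lp.single_apply_self]
    · rw [lp.single_apply_ne _ _ _ hδ,
        lp.single_apply_ne _ _ _ ((update_mul_injective i (FreeMonoid.of j)).ne hδ),
        smul_zero, smul_zero]
  · refine (weightedShift_apply_of_notMem _ _ _ _ _ ω h).trans ?_
    rw [lp.single_apply_ne _ _ _ fun e => h ⟨γ, e.symm⟩, smul_zero]

variable [CompleteSpace K]

theorem adjoint_bigLambda_basisTensor (m : Fin k → ℕ) (i : Fin k) (j : Fin (n i)) (x : K)
    (γ : MultiWord n) :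
    ContinuousLinearMap.adjoint (bigLambda K m i j)
        (basisTensor x (appendAt i (FreeMonoid.of j) γ)) =
      (dWeight (m i) j (γ i) : ℂ) • basisTensor x γ := by
  refine ext_inner_left ℂ fun F => ?_
  rw [ContinuousLinearMap.adjoint_inner_right, inner_smul_right, inner_basisTensor_right,
    inner_basisTensor_right]
  have : bigLambda K m i j F (appendAt i (FreeMonoid.of j) γ) = (dWeight (m i) j (γ i) : ℂ) • F γ :=
    weightedShift_apply _ (update_mul_injective i _) _ _ F γ
  rw [this, inner_smul_left, Complex.conj_ofReal]

theorem adjoint_bigLambda_basisTensor_eq_zero (m : Fin k → ℕ) (i : Fin k) (j : Fin (n i)) (x : K)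
    (ω : MultiWord n) (h : ¬ ∃ γ : MultiWord n, appendAt i (FreeMonoid.of j) γ = ω) :
    ContinuousLinearMap.adjoint (bigLambda K m i j) (basisTensor x ω) = 0 := by
  refine ext_inner_left ℂ fun F => ?_
  have : bigLambda K m i j F ω = 0 := weightedShift_apply_of_notMem _ _ _ _ F ω h
  rw [ContinuousLinearMap.adjoint_inner_right, inner_basisTensor_right, this, inner_zero_left,
    inner_zero_right]

theorem dWeight_pos (m : ℕ) {r : ℕ} (j : Fin r) (α : Word r) : 0 < dWeight m j α :=
  Real.sqrt_pos.2 (div_pos (b_pos _ _) (b_pos _ _))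

theorem adjoint_lambdaRow_comp_single (m : Fin k → ℕ) (i : Fin k) (j : Fin (n i)) (x : K)
    (γ : MultiWord n) :
    (ContinuousLinearMap.adjoint (lambdaRow K (n := n) m i) ∘L lambdaRow K (n := n) m i)
        (PiLp.single 2 j (basisTensor x γ)) =
      ((dWeight (m i) j (γ i) : ℂ) ^ 2) • PiLp.single 2 j (basisTensor x γ) := by
  refine ext_inner_left ℂ fun G => ?_
  rw [ContinuousLinearMap.comp_apply, ContinuousLinearMap.adjoint_inner_right,
    lambdaRow_single, inner_smul_right, lambdaRow_apply, sum_inner, Finset.sum_eq_single j]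
  · rw [← ContinuousLinearMap.adjoint_inner_right, bigLambda_basisTensor, map_smul,
      adjoint_bigLambda_basisTensor, smul_smul, ← sq, inner_smul_right, inner_single_copies_right]
  · intro l _ hl
    exact inner_bigLambda_of_ne m i hl _ _
  · simp

/-- The vectors `δ_j ⊗ x ⊗ e_γ` are eigenvectors of `Λ_i* Λ_i`, so the Cauchy dual of `Λ_i` is again
a weighted shift, with the inverse weights. -/
theorem cauchyDual_lambdaRow_single (m : Fin k → ℕ) (i : Fin k) (hm : 1 ≤ m i) (j : Fin (n i))
    (x : K) (γ : MultiWord n) :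
    cauchyDual (lambdaRow K (n := n) m i) (PiLp.single 2 j (basisTensor x γ)) =
      (dWeight (m i) j (γ i) : ℂ)⁻¹ • basisTensor x (appendAt i (FreeMonoid.of j) γ) := by
  have hw : (dWeight (m i) j (γ i) : ℂ) ≠ 0 := by exact_mod_cast (dWeight_pos _ _ _).ne'
  -- `Ring.inverse` is a true inverse here, because `Λ_i* Λ_i` is invertible for `m i ≥ 1`.
  have h1 := congrArg (fun A => A (PiLp.single 2 j (basisTensor x γ)))
    (Ring.inverse_mul_cancel _ (isUnit_adjoint_lambdaRow_comp (K := K) (n := n) m i hm))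
  simp only [mul_apply_eq_comp, one_apply_eq_self] at h1
  rw [adjoint_lambdaRow_comp_single, map_smul] at h1
  rw [cauchyDual, ContinuousLinearMap.comp_apply,
    (eq_inv_smul_iff₀ (pow_ne_zero 2 hw)).2 h1, map_smul, lambdaRow_single, bigLambda_basisTensor,
    smul_smul]
  congr 1
  field_simp

end Basis

/-! ### Scaled matrix entries and the Brown–Halmos condition -/

section Conjugation
variable {K : Type*} [NormedAddCommGroup K] [InnerProductSpace ℂ K] {k : ℕ} {n : Fin k → ℕ}

/-- `∏_s √b_{γ_s}`, the reciprocal of the weight of the shift that maps `e_{g₀}` to `e_γ`. -/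
def normWeight (m : Fin k → ℕ) (γ : MultiWord n) : ℝ := ∏ s, Real.sqrt (b (m s) (γ s))

theorem normWeight_pos (m : Fin k → ℕ) (γ : MultiWord n) : 0 < normWeight m γ :=
  Finset.prod_pos fun _ _ => Real.sqrt_pos.2 (b_pos _ _)

theorem normWeight_appendAt (m : Fin k → ℕ) (i : Fin k) (j : Fin (n i)) (γ : MultiWord n) :
    normWeight m (appendAt i (FreeMonoid.of j) γ) * dWeight (m i) j (γ i) = normWeight m γ := by
  have hb : b (m i) (γ i * FreeMonoid.of j) = b (m i) (FreeMonoid.of j * γ i) := by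
    simp only [b, FreeMonoid.length_mul, add_comm]
  unfold normWeight
  rw [← Finset.mul_prod_erase _ _ (Finset.mem_univ i),
    ← Finset.mul_prod_erase _ (fun s => Real.sqrt (b (m s) (γ s))) (Finset.mem_univ i),
    mul_right_comm, appendAt, Function.update_self, hb, dWeight, ← Real.sqrt_mul (b_pos _ _).le,
    mul_div_cancel₀ _ (b_pos _ _).ne']
  congr 1
  refine Finset.prod_congr rfl fun s hs => ?_
  rw [Function.update_of_ne (Finset.ne_of_mem_erase hs)]

/-- The matrix entry `⟨S (x ⊗ e_γ), y ⊗ e_ω⟩` (linear in the first variable), multiplied by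
`∏_s √(b_{ω_s} b_{γ_s})`. This scaling makes both sides of the Brown–Halmos condition free of
weights. -/
def scaledEntry (m : Fin k → ℕ) (S : TensorFock K n →L[ℂ] TensorFock K n) (x y : K)
    (ω γ : MultiWord n) : ℂ :=
  (normWeight m ω * normWeight m γ : ℝ) * ⟪basisTensor y ω, S (basisTensor x γ)⟫_ℂ

theorem scaledEntry_sum_smul (m : Fin k → ℕ) (s : Finset ℕ) (c : ℕ → ℂ)
    (S : ℕ → TensorFock K n →L[ℂ] TensorFock K n) (x y : K) (ω γ : MultiWord n) :
    scaledEntry m (∑ p ∈ s, c p • S p) x y ω γ = ∑ p ∈ s, c p * scaledEntry m (S p) x y ω γ := by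
  simp only [scaledEntry, sum_apply, smul_apply, inner_sum,
    inner_smul_right, Finset.mul_sum]
  exact Finset.sum_congr rfl fun p _ => by ring

/-- The word whose letters, read from right to left, are those of the list `u`, so that consing
appends a letter on the right. Right divisibility of words becomes the prefix order of lists. -/
def wordOf {r : ℕ} (u : List (Fin r)) : Word r := FreeMonoid.ofList u.reverse

theorem wordOf_cons {r : ℕ} (a : Fin r) (u : List (Fin r)) :
    wordOf (a :: u) = wordOf u * FreeMonoid.of a := by
  simp [wordOf, FreeMonoid.ofList_append]

/-- The scaled entries of `S` as a function of the `i`-th components of the two multi-words, the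
other components being those of `ω` and `γ`. -/
def entryArray (m : Fin k → ℕ) (S : TensorFock K n →L[ℂ] TensorFock K n) (x y : K)
    (i : Fin k) (ω γ : MultiWord n) (u v : List (Fin (n i))) : ℂ :=
  scaledEntry m S x y (Function.update ω i (wordOf u)) (Function.update γ i (wordOf v))

theorem update_wordOf_cons (i : Fin k) (ω : MultiWord n) (a : Fin (n i)) (u : List (Fin (n i))) :
    Function.update ω i (wordOf (a :: u)) =
      appendAt i (FreeMonoid.of a) (Function.update ω i (wordOf u)) := by
  rw [appendAt, Function.update_self, Function.update_idem, wordOf_cons]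

variable [CompleteSpace K]

/-- The map `S ↦ ∑_j Λ_{i,j} S Λ_{i,j}*`. -/
def conjShift (m : Fin k → ℕ) (i : Fin k) (S : TensorFock K n →L[ℂ] TensorFock K n) :
    TensorFock K n →L[ℂ] TensorFock K n :=
  ∑ j, bigLambda K m i j ∘L S ∘L ContinuousLinearMap.adjoint (bigLambda K m i j)

theorem sum_bigLambdaWord_conj (m : Fin k → ℕ) (i : Fin k) (p : ℕ)
    (T : TensorFock K n →L[ℂ] TensorFock K n) :
    ∑ β : Fin p → Fin (n i),
      bigLambdaWord K m i (FreeMonoid.ofList (List.ofFn β)) ∘L T ∘L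
        ContinuousLinearMap.adjoint (bigLambdaWord K m i (FreeMonoid.ofList (List.ofFn β))) =
      (conjShift m i)^[p] T := by
  induction p with
  | zero =>
    rw [Fintype.sum_unique]
    simp only [List.ofFn_zero, FreeMonoid.ofList_nil, map_one, Function.iterate_zero, id]
    ext1 F
    simp [ContinuousLinearMap.one_def, ContinuousLinearMap.adjoint_id]
  | succ p ih =>
    rw [Function.iterate_succ_apply', ← ih, conjShift,
      ← (Fin.consEquiv fun _ => Fin (n i)).sum_comp, Fintype.sum_prod_type]
    refine Finset.sum_congr rfl fun j _ => ?_
    ext1 F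
    simp [Fin.consEquiv, List.ofFn_succ, FreeMonoid.ofList_cons, bigLambdaWord,
      ContinuousLinearMap.mul_def, ContinuousLinearMap.adjoint_comp, map_sum]

theorem scaledEntry_conjShift_append (m : Fin k → ℕ) (i : Fin k)
    (S : TensorFock K n →L[ℂ] TensorFock K n) (x y : K) (ω γ : MultiWord n) (l j : Fin (n i)) :
    scaledEntry m (conjShift m i S) x y (appendAt i (FreeMonoid.of l) ω)
      (appendAt i (FreeMonoid.of j) γ) = if l = j then scaledEntry m S x y ω γ else 0 := by
  have h0 : ∀ (p q : Fin (n i)) (hpq : p ≠ q) (z : K) (δ : MultiWord n),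
      ContinuousLinearMap.adjoint (bigLambda K m i p)
        (basisTensor z (appendAt i (FreeMonoid.of q) δ)) = 0 := by
    intro p q hpq z δ
    refine ext_inner_left ℂ fun F => ?_
    have hw : (dWeight (m i) q (δ i) : ℂ) ≠ 0 := by exact_mod_cast (dWeight_pos _ _ _).ne'
    -- The basis vector lies in the range of `Λ_{i,q}`, which is orthogonal to that of `Λ_{i,p}`.
    have h := bigLambda_basisTensor m i q z δ
    rw [← inv_smul_eq_iff₀ hw] at h
    rw [← h, map_smul, inner_smul_right, ContinuousLinearMap.adjoint_inner_right,
      inner_bigLambda_of_ne m i hpq, mul_zero, inner_zero_right]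
  have h1 : ∀ p, ⟪basisTensor y (appendAt i (FreeMonoid.of l) ω),
      (bigLambda K m i p ∘L S ∘L ContinuousLinearMap.adjoint (bigLambda K m i p))
        (basisTensor x (appendAt i (FreeMonoid.of j) γ))⟫_ℂ =
      ⟪ContinuousLinearMap.adjoint (bigLambda K m i p)
        (basisTensor y (appendAt i (FreeMonoid.of l) ω)),
        S (ContinuousLinearMap.adjoint (bigLambda K m i p)
          (basisTensor x (appendAt i (FreeMonoid.of j) γ)))⟫_ℂ := fun p => by
    rw [ContinuousLinearMap.adjoint_inner_left]; rfl
  rw [scaledEntry, conjShift, sum_apply, inner_sum, Finset.sum_congr rfl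
    fun p _ => h1 p, Finset.sum_eq_single l]
  · split_ifs with hlj
    · subst hlj
      rw [adjoint_bigLambda_basisTensor, adjoint_bigLambda_basisTensor, map_smul, inner_smul_left,
        inner_smul_right, Complex.conj_ofReal, scaledEntry, ← normWeight_appendAt m i l ω,
        ← normWeight_appendAt m i l γ]
      push_cast
      ring
    · rw [h0 l j hlj, map_zero, inner_zero_right, mul_zero]
  · intro p _ hp
    rw [h0 p l hp, inner_zero_left]
  · simp

theorem scaledEntry_conjShift_of_eq_one (m : Fin k → ℕ) (i : Fin k)
    (S : TensorFock K n →L[ℂ] TensorFock K n) (x y : K) (ω γ : MultiWord n)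
    (h : ω i = 1 ∨ γ i = 1) : scaledEntry m (conjShift m i S) x y ω γ = 0 := by
  have h0 : ∀ (p : Fin (n i)) (z : K) (δ : MultiWord n), δ i = 1 →
      ContinuousLinearMap.adjoint (bigLambda K m i p) (basisTensor z δ) = 0 := by
    intro p z δ hδ
    refine adjoint_bigLambda_basisTensor_eq_zero m i p z δ ?_
    rintro ⟨ε, rfl⟩
    have := congrArg FreeMonoid.length hδ
    simp [FreeMonoid.length_mul] at this
  rw [scaledEntry, conjShift, sum_apply, inner_sum, Finset.sum_eq_zero,
    mul_zero]
  intro p _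
  rw [ContinuousLinearMap.comp_apply, ← ContinuousLinearMap.adjoint_inner_left]
  rcases h with h | h
  · rw [h0 p y ω h, inner_zero_left]
  · rw [ContinuousLinearMap.comp_apply, h0 p x γ h, map_zero, inner_zero_right]

/-- On scaled entries, `S ↦ ∑_j Λ_{i,j} S Λ_{i,j}*` acts as the diagonal shift. -/
theorem entryArray_conjShift (m : Fin k → ℕ) (S : TensorFock K n →L[ℂ] TensorFock K n) (x y : K)
    (i : Fin k) (ω γ : MultiWord n) :
    entryArray m (conjShift m i S) x y i ω γ = diagShift _ (entryArray m S x y i ω γ) := by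
  funext u v
  by_cases h : u = [] ∨ v = []
  · rw [diagShift_of_nil _ h]
    refine scaledEntry_conjShift_of_eq_one m i S x y _ _ ?_
    simp only [Function.update_self]
    rcases h with rfl | rfl
    · exact Or.inl rfl
    · exact Or.inr rfl
  · rw [not_or] at h
    obtain ⟨a, u, rfl⟩ := List.exists_cons_of_ne_nil h.1
    obtain ⟨c, v, rfl⟩ := List.exists_cons_of_ne_nil h.2
    rw [diagShift_cons, entryArray, update_wordOf_cons, update_wordOf_cons,
      scaledEntry_conjShift_append]
    rfl

theorem entryArray_conjShift_iterate (m : Fin k → ℕ) (S : TensorFock K n →L[ℂ] TensorFock K n)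
    (x y : K) (i : Fin k) (ω γ : MultiWord n) (p : ℕ) :
    entryArray m ((conjShift m i)^[p] S) x y i ω γ =
      (diagShift _ ^ p) (entryArray m S x y i ω γ) := by
  induction p with
  | zero => rfl
  | succ p ih => rw [Function.iterate_succ_apply', entryArray_conjShift, ih, pow_succ']; rfl

/-- The equation `Λ_i'* T Λ_i' = diag(A)` in terms of scaled entries: the inverse weights of the Cauchy
duals are absorbed by the scaling. -/
theorem brownHalmos_at_iff (m : Fin k → ℕ) (i : Fin k) (hm : 1 ≤ m i)
    (T A : TensorFock K n →L[ℂ] TensorFock K n) :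
    ContinuousLinearMap.adjoint (cauchyDual (lambdaRow K (n := n) m i)) ∘L T ∘L
        cauchyDual (lambdaRow K (n := n) m i) = diagOp (n i) A ↔
      ∀ (x y : K) (ω γ : MultiWord n) (l j : Fin (n i)),
        scaledEntry m T x y (appendAt i (FreeMonoid.of l) ω) (appendAt i (FreeMonoid.of j) γ) =
          if l = j then scaledEntry m A x y ω γ else 0 := by
  have key : ∀ (x y : K) (ω γ : MultiWord n) (l j : Fin (n i)),
      (⟪PiLp.single 2 l (basisTensor y ω),
        (ContinuousLinearMap.adjoint (cauchyDual (lambdaRow K (n := n) m i)) ∘L T ∘L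
          cauchyDual (lambdaRow K (n := n) m i)) (PiLp.single 2 j (basisTensor x γ))⟫_ℂ =
        ⟪PiLp.single 2 l (basisTensor y ω),
          diagOp (n i) A (PiLp.single 2 j (basisTensor x γ))⟫_ℂ) ↔
      scaledEntry m T x y (appendAt i (FreeMonoid.of l) ω) (appendAt i (FreeMonoid.of j) γ) =
          if l = j then scaledEntry m A x y ω γ else 0 := by
    intro x y ω γ l j
    have hω : (dWeight (m i) l (ω i) : ℂ) ≠ 0 := by exact_mod_cast (dWeight_pos _ _ _).ne'
    have hγ : (dWeight (m i) j (γ i) : ℂ) ≠ 0 := by exact_mod_cast (dWeight_pos _ _ _).ne'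
    have hN : ((normWeight m ω * normWeight m γ : ℝ) : ℂ) ≠ 0 := by
      exact_mod_cast (mul_pos (normWeight_pos m ω) (normWeight_pos m γ)).ne'
    rw [ContinuousLinearMap.comp_apply, ContinuousLinearMap.adjoint_inner_right,
      ContinuousLinearMap.comp_apply, cauchyDual_lambdaRow_single m i hm,
      cauchyDual_lambdaRow_single m i hm, map_smul, inner_smul_left, inner_smul_right,
      inner_single_copies_left, diagOp_single_apply, ← mul_right_inj' hN]
    refine Eq.congr ?_ ?_
    · rw [scaledEntry, ← normWeight_appendAt m i l ω, ← normWeight_appendAt m i j γ, map_inv₀,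
        Complex.conj_ofReal]
      push_cast
      field_simp
    · split_ifs
      · rfl
      · simp
  rw [ext_single_basisTensor_iff]
  simp only [key]
  exact ⟨fun h x y ω γ l j => h l j ω γ x y, fun h l j ω γ x y => h x y ω γ l j⟩

theorem brownHalmos_iff_isToeplitzArray (m : Fin k → ℕ) (hm : ∀ i, 1 ≤ m i)
    (T : TensorFock K n →L[ℂ] TensorFock K n) :
    BrownHalmos m T ↔ ∀ (i : Fin k) (x y : K) (ω γ : MultiWord n),
      IsToeplitzArray (m i) (entryArray m T x y i ω γ) (entryArray m T x y i ω γ) := by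
  unfold BrownHalmos
  refine forall_congr' fun i => ?_
  simp only [sum_bigLambdaWord_conj]
  rw [brownHalmos_at_iff m i (hm i)]
  refine forall_congr' fun x => forall_congr' fun y => ?_
  simp only [isToeplitzArray_self_iff, scaledEntry_sum_smul, ← entryArray_conjShift_iterate]
  constructor
  · intro h ω γ a u c v
    rw [entryArray, update_wordOf_cons, update_wordOf_cons, h]
    rfl
  · intro h ω γ l j
    have := h ω γ l (FreeMonoid.toList (ω i)).reverse j (FreeMonoid.toList (γ i)).reverse
    have e : ∀ δ : MultiWord n,
        Function.update δ i (wordOf (FreeMonoid.toList (δ i)).reverse) = δ := by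
      intro δ
      simp [wordOf]
    simpa only [entryArray, update_wordOf_cons, e] using this

end Conjugation

/-! ### Right divisibility of words -/

section Words
variable {r : ℕ}

theorem wordOf_append (q u : List (Fin r)) : wordOf (q ++ u) = wordOf u * wordOf q := by
  simp [wordOf, FreeMonoid.ofList_append]

theorem wordOf_surjective : Function.Surjective (wordOf (r := r)) := fun w =>
  ⟨(FreeMonoid.toList w).reverse, by simp [wordOf]⟩

theorem wordOf_injective : Function.Injective (wordOf (r := r)) := fun u v h => by
  simpa [wordOf] using h

theorem wordOf_eq_one_iff {u : List (Fin r)} : wordOf u = 1 ↔ u = [] :=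
  ⟨fun h => wordOf_injective h, fun h => h ▸ rfl⟩

theorem rightGE_wordOf_iff {u v : List (Fin r)} : RightGE (wordOf v) (wordOf u) ↔ u <+: v := by
  constructor
  · rintro ⟨σ, h⟩
    obtain ⟨t, rfl⟩ := wordOf_surjective σ
    exact ⟨t, wordOf_injective (by rw [wordOf_append, h])⟩
  · rintro ⟨t, rfl⟩
    exact ⟨wordOf t, wordOf_append u t⟩

theorem b_eq_multichoose {m : ℕ} (hm : 1 ≤ m) (w : Word r) : b m w = m.multichoose w.length := by
  rw [b, Nat.multichoose_eq, add_comm w.length m, Nat.cast_inj]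
  exact Nat.choose_symm_of_eq_add (by omega)

theorem b_one {m : ℕ} : b m (1 : Word r) = 1 := by
  simp [b]

theorem rightGE_mul_right_iff {ω γ : Word r} (q : Word r) :
    RightGE (ω * q) (γ * q) ↔ RightGE ω γ := by
  simp only [RightGE, ← mul_assoc, mul_left_inj]

theorem rightQuot_mul_right (ω γ q : Word r) : rightQuot (ω * q) (γ * q) = rightQuot ω γ := by
  by_cases h : RightGE ω γ
  · obtain ⟨σ, rfl⟩ := h
    rw [mul_assoc, rightQuot_mul, rightQuot_mul]
  · rw [rightQuot_of_not h, rightQuot_of_not (mt (rightGE_mul_right_iff q).1 h)]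

theorem wordMin_mul_right (ω γ q : Word r) : wordMin (ω * q) (γ * q) = wordMin ω γ * q := by
  by_cases h : RightGE ω γ
  · rw [wordMin, wordMin, if_pos h, if_pos ((rightGE_mul_right_iff q).2 h)]
  · rw [wordMin, wordMin, if_neg h, if_neg (mt (rightGE_mul_right_iff q).1 h)]

theorem eq_one_of_rightGE_one {γ : Word r} (h : RightGE 1 γ) : γ = 1 := by
  obtain ⟨σ, h⟩ := h
  have := congrArg FreeMonoid.length h
  rw [FreeMonoid.length_mul, FreeMonoid.length_one] at this
  exact FreeMonoid.length_eq_zero.1 (by omega)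

theorem wordMin_eq_one {ω γ : Word r} (h : ω = 1 ∨ γ = 1) : wordMin ω γ = 1 := by
  rw [wordMin]
  split_ifs with hge
  · rcases h with rfl | h
    · exact eq_one_of_rightGE_one hge
    · exact h
  · rcases h with h | rfl
    · exact h
    · exact absurd ⟨ω, (mul_one ω).symm⟩ hge

theorem rightQuot_eq_one_or (ω γ : Word r) : rightQuot ω γ = 1 ∨ rightQuot γ ω = 1 := by
  by_cases h : RightGE ω γ
  · obtain ⟨σ, rfl⟩ := h
    by_cases h' : RightGE γ (σ * γ)
    · have : RightGE (1 * γ) (σ * γ) := by rwa [one_mul]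
      obtain rfl := eq_one_of_rightGE_one ((rightGE_mul_right_iff γ).1 this)
      exact Or.inl (by rw [rightQuot_mul])
    · exact Or.inr (rightQuot_of_not h')
  · exact Or.inl (rightQuot_of_not h)

theorem rightQuot_mul_wordMin {ω γ : Word r} (h : RightGE ω γ ∨ RightGE γ ω) :
    rightQuot ω γ * wordMin ω γ = ω ∧ rightQuot γ ω * wordMin ω γ = γ := by
  by_cases h1 : RightGE ω γ
  · rw [wordMin, if_pos h1]
    obtain ⟨σ, rfl⟩ := h1
    have := rightQuot_mul_right 1 σ γ
    rw [one_mul] at this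
    rw [rightQuot_mul, this]
    refine ⟨rfl, ?_⟩
    rw [mul_eq_right]
    by_cases h2 : RightGE 1 σ
    · rw [eq_one_of_rightGE_one h2]
      simpa using rightQuot_mul (1 : Word r) 1
    · exact rightQuot_of_not h2
  · obtain ⟨σ, rfl⟩ := h.resolve_left h1
    rw [wordMin, if_neg h1, rightQuot_mul, rightQuot_of_not h1]
    exact ⟨one_mul _, rfl⟩

theorem sqrt_div_mul_sqrt_mul_sqrt (m : ℕ) (ω γ : Word r) :
    √(b m (wordMin ω γ) / b m (wordMax ω γ)) * (√(b m ω) * √(b m γ)) = b m (wordMin ω γ) := by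
  have h : √(b m ω) * √(b m γ) = √(b m (wordMin ω γ)) * √(b m (wordMax ω γ)) := by
    unfold wordMin wordMax
    split_ifs
    · exact mul_comm _ _
    · rfl
  have h0 := Real.sqrt_pos.2 (b_pos m (wordMax ω γ))
  rw [h, Real.sqrt_div (b_pos _ _).le, mul_left_comm, div_mul_cancel₀ _ h0.ne',
    Real.mul_self_sqrt (b_pos _ _).le]

end Words

/-! ### Weighted multi-Toeplitz operators -/

section Toeplitz
variable {K : Type*} [NormedAddCommGroup K] [InnerProductSpace ℂ K] {k : ℕ} {n : Fin k → ℕ}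

theorem mem_comparablePairs_iff {ω γ : MultiWord n} :
    (ω, γ) ∈ comparablePairs n ↔ ∀ i, RightGE (ω i) (γ i) ∨ RightGE (γ i) (ω i) := by
  refine forall_congr' fun i => ⟨?_, ?_⟩
  · rintro (⟨σ, -, h⟩ | ⟨σ, -, h⟩ | h)
    · exact Or.inr ⟨σ, h⟩
    · exact Or.inl ⟨σ, h⟩
    · exact Or.inl ⟨1, by rw [one_mul]; exact h⟩
  · rintro (⟨σ, h⟩ | ⟨σ, h⟩)
    · by_cases hσ : σ = 1
      · exact Or.inr (Or.inr (by simpa [hσ] using h))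
      · exact Or.inr (Or.inl ⟨σ, hσ, h⟩)
    · by_cases hσ : σ = 1
      · exact Or.inr (Or.inr (by simpa [hσ] using h.symm))
      · exact Or.inl ⟨σ, hσ, h⟩

theorem tau_mul_normWeight (m : Fin k → ℕ) (ω γ : MultiWord n) :
    tau m ω γ * (normWeight m ω * normWeight m γ) = ∏ i, b (m i) (wordMin (ω i) (γ i)) := by
  rw [tau, normWeight, normWeight, ← Finset.prod_mul_distrib, ← Finset.prod_mul_distrib]
  exact Finset.prod_congr rfl fun i _ => sqrt_div_mul_sqrt_mul_sqrt _ _ _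

theorem isWeightedMultiToeplitz_iff (m : Fin k → ℕ) (T : TensorFock K n →L[ℂ] TensorFock K n) :
    IsWeightedMultiToeplitz m T ↔ ∃ A : reducedPairs n → K →L[ℂ] K,
      ∀ (ω γ : MultiWord n) (x y : K),
        (∀ h : (ω, γ) ∈ comparablePairs n, scaledEntry m T x y ω γ =
          (∏ i, b (m i) (wordMin (ω i) (γ i)) : ℝ) *
            ⟪y, A (simplification ⟨(ω, γ), h⟩) x⟫_ℂ) ∧
        ((ω, γ) ∉ comparablePairs n → scaledEntry m T x y ω γ = 0) := by
  refine exists_congr fun A => forall_congr' fun ω => forall_congr' fun γ =>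
    forall_congr' fun x => forall_congr' fun y => ?_
  have hN : ((normWeight m ω * normWeight m γ : ℝ) : ℂ) ≠ 0 := by
    exact_mod_cast (mul_pos (normWeight_pos m ω) (normWeight_pos m γ)).ne'
  refine and_congr (forall_congr' fun h => ?_) (imp_congr_right fun h => ?_)
  · rw [← tau_mul_normWeight, scaledEntry, mul_comm (tau m ω γ), Complex.ofReal_mul _ (tau m ω γ),
      mul_assoc, mul_right_inj' hN]
  · rw [scaledEntry, mul_eq_zero, or_iff_right hN]

theorem isToeplitzArray_entryArray_iff (m : Fin k → ℕ) (i : Fin k) (hm : 1 ≤ m i)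
    (T : TensorFock K n →L[ℂ] TensorFock K n) (x y : K) :
    (∀ ω γ : MultiWord n,
      IsToeplitzArray (m i) (entryArray m T x y i ω γ) (entryArray m T x y i ω γ)) ↔
      (∀ (ω γ : MultiWord n) (q : Word (n i)), ω i = 1 ∨ γ i = 1 →
        scaledEntry m T x y (appendAt i q ω) (appendAt i q γ) =
          b (m i) q * scaledEntry m T x y ω γ) ∧
      ∀ ω γ : MultiWord n, ¬ RightGE (ω i) (γ i) → ¬ RightGE (γ i) (ω i) →
        scaledEntry m T x y ω γ = 0 := by
  have hb : ∀ q : List (Fin (n i)),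
      ((m i).multichoose q.length : ℂ) = (b (m i) (wordOf q) : ℝ) := by
    intro q
    rw [b_eq_multichoose hm]
    simp [wordOf, FreeMonoid.length]
  have hu : ∀ (ω : MultiWord n) (q u : List (Fin (n i))),
      Function.update ω i (wordOf (q ++ u)) =
        appendAt i (wordOf q) (Function.update ω i (wordOf u)) := by
    intro ω q u
    rw [appendAt, Function.update_self, Function.update_idem, wordOf_append]
  constructor
  · intro h
    refine ⟨fun ω γ q hq => ?_, fun ω γ h1 h2 => ?_⟩
    all_goals
      obtain ⟨u, hωu⟩ := wordOf_surjective (ω i)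
      obtain ⟨v, hγv⟩ := wordOf_surjective (γ i)
    · obtain ⟨q, rfl⟩ := wordOf_surjective q
      have := (h ω γ).1 q u v (by rwa [← hωu, ← hγv, wordOf_eq_one_iff, wordOf_eq_one_iff] at hq)
      rwa [hb, entryArray, entryArray, hu, hu, hωu, hγv, Function.update_eq_self,
        Function.update_eq_self] at this
    · rw [← hωu, ← hγv, rightGE_wordOf_iff] at h1 h2
      have := (h ω γ).2 u v h2 h1
      rwa [entryArray, hωu, hγv, Function.update_eq_self, Function.update_eq_self] at this
  · rintro ⟨h1, h2⟩ ω γ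
    refine ⟨fun q u v huv => ?_, fun u v hu hv => ?_⟩
    · rw [hb, entryArray, entryArray, hu, hu]
      refine h1 _ _ _ ?_
      rwa [Function.update_self, Function.update_self, wordOf_eq_one_iff, wordOf_eq_one_iff]
    · refine h2 _ _ ?_ ?_ <;> rw [Function.update_self, Function.update_self, rightGE_wordOf_iff] <;>
        assumption

theorem appendAt_mem_comparablePairs_iff (i : Fin k) (q : Word (n i)) {ω γ : MultiWord n} :
    (appendAt i q ω, appendAt i q γ) ∈ comparablePairs n ↔ (ω, γ) ∈ comparablePairs n := by
  simp only [mem_comparablePairs_iff]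
  refine forall_congr' fun s => ?_
  by_cases hs : s = i
  · subst hs
    simp only [appendAt, Function.update_self, rightGE_mul_right_iff]
  · simp only [appendAt, Function.update_of_ne hs]

theorem simplification_appendAt (i : Fin k) (q : Word (n i)) {ω γ : MultiWord n}
    (h : (ω, γ) ∈ comparablePairs n)
    (h' : (appendAt i q ω, appendAt i q γ) ∈ comparablePairs n) :
    simplification ⟨_, h'⟩ = simplification ⟨_, h⟩ := by
  refine Subtype.ext (Prod.ext (funext fun s => ?_) (funext fun s => ?_)) <;>
  · by_cases hs : s = i
    · subst hs
      simp only [simplification, appendAt, Function.update_self, rightQuot_mul_right]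
    · simp only [simplification, appendAt, Function.update_of_ne hs]

theorem prod_b_wordMin_appendAt (m : Fin k → ℕ) (i : Fin k) (q : Word (n i)) {ω γ : MultiWord n}
    (h : ω i = 1 ∨ γ i = 1) :
    ∏ s, b (m s) (wordMin (appendAt i q ω s) (appendAt i q γ s)) =
      b (m i) q * ∏ s, b (m s) (wordMin (ω s) (γ s)) := by
  rw [← Finset.mul_prod_erase _ _ (Finset.mem_univ i),
    ← Finset.mul_prod_erase _ (fun s => b (m s) (wordMin (ω s) (γ s))) (Finset.mem_univ i),
    appendAt, appendAt, Function.update_self, Function.update_self, wordMin_mul_right,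
    wordMin_eq_one h, one_mul, b_one, one_mul]
  congr 1
  refine Finset.prod_congr rfl fun s hs => ?_
  rw [Function.update_of_ne (Finset.ne_of_mem_erase hs),
    Function.update_of_ne (Finset.ne_of_mem_erase hs)]

/-- A function which gains the factor `b_q` whenever `q` is appended to the `i`-th components of a
pair of multi-words one of which is empty there can be reduced to the quotients `ω_i \_r γ_i`,
`γ_i \_r ω_i` in any set of coordinates. -/
theorem eq_prod_mul_of_appendAt (m : Fin k → ℕ) (E : MultiWord n → MultiWord n → ℂ)
    (hE : ∀ (i : Fin k) (ω γ : MultiWord n) (q : Word (n i)), ω i = 1 ∨ γ i = 1 →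
      E (appendAt i q ω) (appendAt i q γ) = b (m i) q * E ω γ)
    {ω γ : MultiWord n} (h : (ω, γ) ∈ comparablePairs n) (s : Finset (Fin k)) :
    E ω γ = (∏ i ∈ s, b (m i) (wordMin (ω i) (γ i)) : ℝ) *
      E (s.piecewise (fun i => rightQuot (ω i) (γ i)) ω)
        (s.piecewise (fun i => rightQuot (γ i) (ω i)) γ) := by
  classical
  induction s using Finset.induction_on with
  | empty => simp
  | insert i s hi ih =>
    obtain ⟨h1, h2⟩ := rightQuot_mul_wordMin (mem_comparablePairs_iff.1 h i)
    rw [ih, Finset.prod_insert hi, Finset.piecewise_insert, Finset.piecewise_insert,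
      Complex.ofReal_mul, mul_comm (b (m i) _ : ℂ), mul_assoc, ← hE i]
    · simp only [appendAt, Function.update_self, Function.update_idem, h1, h2]
      congr 2
      · refine (Function.update_eq_self_iff.2 ?_).symm
        rw [Finset.piecewise_eq_of_notMem _ _ _ hi]
      · refine (Function.update_eq_self_iff.2 ?_).symm
        rw [Finset.piecewise_eq_of_notMem _ _ _ hi]
    · rw [Function.update_self, Function.update_self]
      exact rightQuot_eq_one_or _ _

open Classical in
/-- The operator `A_{(σ;β)}` on `K` whose form is the scaled entry of `T` at `(σ, β)`. -/
def coefficient (m : Fin k → ℕ) (T : TensorFock K n →L[ℂ] TensorFock K n) (p : reducedPairs n) :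
    K →L[ℂ] K :=
  ((normWeight m p.1.1 * normWeight m p.1.2 : ℝ) : ℂ) •
    (lp.evalCLM ℂ (fun _ : MultiWord n => K) 2 p.1.1 ∘L T ∘L
      lp.singleContinuousLinearMap ℂ (fun _ : MultiWord n => K) 2 p.1.2)

theorem inner_coefficient (m : Fin k → ℕ) (T : TensorFock K n →L[ℂ] TensorFock K n)
    (p : reducedPairs n) (x y : K) :
    ⟪y, coefficient m T p x⟫_ℂ = scaledEntry m T x y p.1.1 p.1.2 := by
  classical
  rw [scaledEntry, inner_basisTensor_left, basisTensor_eq_single, coefficient,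
    smul_apply, inner_smul_right]
  rfl

theorem isWeightedMultiToeplitz_iff_isToeplitzArray (m : Fin k → ℕ) (hm : ∀ i, 1 ≤ m i)
    (T : TensorFock K n →L[ℂ] TensorFock K n) :
    IsWeightedMultiToeplitz m T ↔ ∀ (i : Fin k) (x y : K) (ω γ : MultiWord n),
      IsToeplitzArray (m i) (entryArray m T x y i ω γ) (entryArray m T x y i ω γ) := by
  rw [isWeightedMultiToeplitz_iff]
  simp only [isToeplitzArray_entryArray_iff m _ (hm _)]
  constructor
  · rintro ⟨A, hA⟩ i x y
    refine ⟨fun ω γ q hq => ?_, fun ω γ h1 h2 => (hA ω γ x y).2 fun h => ?_⟩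
    · by_cases h : (ω, γ) ∈ comparablePairs n
      · have h' := (appendAt_mem_comparablePairs_iff i q).2 h
        rw [(hA _ _ x y).1 h', (hA ω γ x y).1 h, simplification_appendAt i q h h',
          prod_b_wordMin_appendAt m i q hq, Complex.ofReal_mul, mul_assoc]
      · rw [(hA _ _ x y).2 (mt (appendAt_mem_comparablePairs_iff i q).1 h), (hA ω γ x y).2 h,
          mul_zero]
    · exact (mem_comparablePairs_iff.1 h i).elim h1 h2
  · intro H
    refine ⟨coefficient m T, fun ω γ x y => ⟨fun h => ?_, fun h => ?_⟩⟩
    · rw [inner_coefficient]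
      have := eq_prod_mul_of_appendAt m (scaledEntry m T x y) (fun i => (H i x y).1) h Finset.univ
      rwa [Finset.piecewise_univ, Finset.piecewise_univ] at this
    · rw [mem_comparablePairs_iff, not_forall] at h
      obtain ⟨i, hi⟩ := h
      rw [not_or] at hi
      exact (H i x y).2 ω γ hi.1 hi.2

end Toeplitz

end PolyHyperball

end

theorem mainTheorem2 {k : ℕ} (n m : Fin k → ℕ) (hn : ∀ i, 1 ≤ n i) (hm : ∀ i, 1 ≤ m i)
    {K : Type*} [NormedAddCommGroup K] [InnerProductSpace ℂ K] [CompleteSpace K]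
    [TopologicalSpace.SeparableSpace K]
    (T : PolyHyperball.TensorFock K n →L[ℂ] PolyHyperball.TensorFock K n) :
    PolyHyperball.BrownHalmos m T ↔ PolyHyperball.IsWeightedMultiToeplitz m T := by
  rw [PolyHyperball.brownHalmos_iff_isToeplitzArray m hm,
    PolyHyperball.isWeightedMultiToeplitz_iff_isToeplitzArray m hm]
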